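/- Let $1\le n\le N$, and let $P\in[0,1]^{N\times N}$ be a symmetric matrix with block partition $P=\begin{pmatrix}P_{11}&P_{12}\\P_{21}&P_{22}\end{pmatrix}$, where $P_{11}$ is $n\times n$. Write $p^*=\max_{i,j}P_{ij}$ and let $\sigma_k(M)$ denote the $k$-th largest singular value of $M$. Let $A$ be the adjacency matrix of an inhomogeneous Erdős–Rényi network: $A$ is a symmetric random $0$-$1$ matrix whose entries $A_{ij}$, $i<j$, are independent with $A_{ij}\sim\mathrm{Bernoulli}(P_{ij})$ (the diagonal of $A$ may be any $0$-$1$ valued variables). The blocks $A_{11},A_{12}$ are observed and $A_{22}$ is not. Assume, for constants $\psi,c_1,c_2>0$: * $\operatorname{rank}(P_{11})=\operatorname{rank}(P)=K\le c_1\sqrt{\log n}$; * $\psi^{-1}np^*\le\sigma_K(P_{11})\le\sigma_1(P_{11})\le\psi\,np^*$ and $\psi^{-1}Np^*\le\sigma_K(P)\le\sigma_1(P)\le\psi\,Np^*$; * $np^*\ge c_2\log n$. Define the estimator $\hat P=\begin{pmatrix}\hat P_{11}&\hat P_{12}\\ \hat P_{12}^T&\hat P_{22}\end{pmatrix}$ as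 follows. $(\hat P_{11},\hat P_{12})$ is the rank-$K$ truncated singular value decomposition of the $n\times N$ matrix $(A_{11},A_{12})$, and $\hat P_{22}=A_{12}^T\tilde P_{11}^{+}A_{12}$, where $\tilde P_{11}$ is the rank-$K$ truncated singular value decomposition of $A_{11}$ and $^+$ is the Moore–Penrose inverse. (In case of ties among singular values, any choice is allowed.) Optionally, $\hat P_{11}$ is replaced by $\frac12(\hat P_{11}+\hat P_{11}^T)$, and optionally the entries of $\hat P_{11},\hat P_{12}$ (and correspondingly $\hat P_{21}=\hat P_{12}^T$), or of $\hat P_{22}$, or of all these blocks, are truncated to $[0,1]$. Then there is a constant $C>0$ depending only on $\psi,c_1,c_2$ such that, with probability tending to $1$ as $n\to\infty$ (uniformly over all $N\ge n$, $K$ and $P$ satisfying the assumptions), every such $\hat P$ satisfies $$\|\hat P-P\|_F\le C\sqrt K\left(\Big(\frac Nn\Big)^{3/2}\sqrt{KNp^*}+\frac{N^2}{n^2}\log n\right).$$ -/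

import Mathlib

open Matrix MeasureTheory ProbabilityTheory

noncomputable section

namespace Egocentric

/-- The Frobenius norm `(∑ᵢⱼ Mᵢⱼ²)^{1/2}`. -/
def frobNorm {α β : Type*} [Fintype α] [Fintype β] (M : Matrix α β ℝ) : ℝ :=
  Real.sqrt (∑ i, ∑ j, M i j ^ 2)

/-- The `k`-th largest singular value of `M`, for `k = 1, 2, …`
(Mathlib numbers the singular values from `0`). -/
def sigma {α β : Type*} [Fintype α] [Fintype β] [DecidableEq β]
    (k : ℕ) (M : Matrix α β ℝ) : ℝ :=
  (Matrix.toLpLin 2 2 M).singularValues (k - 1)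

/-- The largest entry of `P` (the index sets used below are finite and nonempty). -/
def pMax {α β : Type*} (P : Matrix α β ℝ) : ℝ :=
  ⨆ e : α × β, P e.1 e.2

/-- `X` is the Moore-Penrose inverse of `M`: the four Penrose equations, which have
exactly one solution. -/
structure IsMoorePenrose {α β : Type*} [Fintype α] [Fintype β]
    (M : Matrix α β ℝ) (X : Matrix β α ℝ) : Prop where
  mul_mul_self : M * X * M = M
  self_mul_mul : X * M * X = X
  symm_left : (M * X).IsSymm
  symm_right : (X * M).IsSymm

/-- `M = U D Vᵀ` is a (thin) singular value decomposition: the columns of `U` and of `V` are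
orthonormal and `D = diag d` holds the `min |α| |β|` singular values in non-increasing order.
For a square `M` the matrices `U` and `V` are orthogonal. -/
structure IsSVD {α β : Type*} [Fintype α] [Fintype β] (M : Matrix α β ℝ)
    (U : Matrix α (Fin (min (Fintype.card α) (Fintype.card β))) ℝ)
    (d : Fin (min (Fintype.card α) (Fintype.card β)) → ℝ)
    (V : Matrix β (Fin (min (Fintype.card α) (Fintype.card β))) ℝ) : Prop where
  orthonormal_left : Uᵀ * U = 1
  orthonormal_right : Vᵀ * V = 1
  nonneg : ∀ k, 0 ≤ d k
  antitone : Antitone d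
  eq_mul : M = U * Matrix.diagonal d * Vᵀ

/-- `T` is a rank-`K` truncated SVD of `M`, i.e. `T = U_(K) D_(K) V_(K)ᵀ` for some SVD
`M = U D Vᵀ`; dropping all columns but the first `K` is the same as
replacing all singular values but the first `K` by zero.
(`T` is unique unless the `K`-th and the `K+1`-st singular values coincide.) -/
def IsTruncatedSVD {α β : Type*} [Fintype α] [Fintype β] (K : ℕ)
    (M T : Matrix α β ℝ) : Prop :=
  ∃ U d V, IsSVD M U d V ∧
    T = U * Matrix.diagonal (fun k : Fin _ => if (k : ℕ) < K then d k else 0) * Vᵀ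

/-- Entrywise truncation to `[0,1]`. -/
def clip {α β : Type*} (M : Matrix α β ℝ) : Matrix α β ℝ :=
  M.map fun x => max 0 (min 1 x)

/-- `R` is an output, before the optional entrywise truncation, of the low-rank estimation (LE)
algorithm with inputs `A11`, `A12`, `K`. -/
def IsLEOutput {n m : ℕ} (K : ℕ) (A11 : Matrix (Fin n) (Fin n) ℝ)
    (A12 : Matrix (Fin n) (Fin m) ℝ) (R : Matrix (Fin m) (Fin m) ℝ) : Prop :=
  ∃ T X, IsTruncatedSVD K A11 T ∧ IsMoorePenrose T X ∧ R = A12ᵀ * X * A12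

/-- `Phat` is a full-matrix estimate computed from the observed blocks of `A`, where the first
`n` nodes are the observed ones. The flags switch on the optional steps: symmetrization of the
first block, truncation of the blocks `11`, `12`, `21` to `[0,1]`, and truncation of the block
`22` to `[0,1]`. -/
def IsFullEstimate {n m : ℕ} (symmetrize clipObs clipMiss : Bool) (K : ℕ)
    (A Phat : Matrix (Fin n ⊕ Fin m) (Fin n ⊕ Fin m) ℝ) : Prop :=
  ∃ (T : Matrix (Fin n) (Fin n ⊕ Fin m) ℝ) (R : Matrix (Fin m) (Fin m) ℝ),
    IsTruncatedSVD K (Matrix.fromCols A.toBlocks₁₁ A.toBlocks₁₂) T ∧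
    IsLEOutput K A.toBlocks₁₁ A.toBlocks₁₂ R ∧
    (let B11 := if symmetrize then (1 / 2 : ℝ) • (T.toCols₁ + T.toCols₁ᵀ) else T.toCols₁
     let Q11 := if clipObs then clip B11 else B11
     let Q12 := if clipObs then clip T.toCols₂ else T.toCols₂
     let Q22 := if clipMiss then clip R else R
     Phat = Matrix.fromBlocks Q11 Q12 Q12ᵀ Q22)

/-- `A` is the adjacency matrix of an inhomogeneous Erdős–Rényi network with probability matrix
`P`: a symmetric random 0-1 matrix whose entries above the diagonal are independent with
`A i j ∼ Bernoulli (P i j)`. The nodes are ordered with the first `n` (observed) ones first.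
The diagonal of `A` is not restricted beyond being 0-1 valued, so both networks without
self-loops and networks with random self-loops are covered. -/
structure IsInhomogeneousER {Ω : Type*} [MeasurableSpace Ω] (μ : Measure Ω) {n m : ℕ}
    (P : Matrix (Fin n ⊕ Fin m) (Fin n ⊕ Fin m) ℝ)
    (A : Ω → Matrix (Fin n ⊕ Fin m) (Fin n ⊕ Fin m) ℝ) : Prop where
  measurable : ∀ i j, Measurable fun ω => A ω i j
  symm : ∀ ω, (A ω).IsSymm
  zero_or_one : ∀ ω i j, A ω i j = 0 ∨ A ω i j = 1
  bernoulli : ∀ i j, toLex i < toLex j → μ.real {ω | A ω i j = 1} = P i j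
  indep : iIndepFun
    (fun (e : {e : (Fin n ⊕ Fin m) × (Fin n ⊕ Fin m) // toLex e.1 < toLex e.2}) ω =>
      A ω e.1.1 e.1.2) μ

/-- The standing assumptions on the probability matrix `P` of a network with `N = n + m` nodes,
`n` of which are observed, with constants `ψ`, `c₁`, `c₂`. -/
structure IsAdmissible (ψ c₁ c₂ : ℝ) (N n m K : ℕ)
    (P : Matrix (Fin n ⊕ Fin m) (Fin n ⊕ Fin m) ℝ) : Prop where
  card : N = n + m
  symm : P.IsSymm
  mem_Icc : ∀ i j, P i j ∈ Set.Icc (0 : ℝ) 1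
  rank_eq : P.rank = K
  rank_block_eq : P.toBlocks₁₁.rank = K
  rank_le : (K : ℝ) ≤ c₁ * Real.sqrt (Real.log n)
  block_lower : ψ⁻¹ * (n * pMax P) ≤ sigma K P.toBlocks₁₁
  block_upper : sigma 1 P.toBlocks₁₁ ≤ ψ * (n * pMax P)
  full_lower : ψ⁻¹ * (N * pMax P) ≤ sigma K P
  full_upper : sigma 1 P ≤ ψ * (N * pMax P)
  density : c₂ * Real.log n ≤ n * pMax P

end Egocentric

end

/-!
# Estimation of a network from the adjacency of a subset of its nodes

Write `p` for the largest entry of `P`, `N = n + m`, and `W = A - P`. The argument has a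
deterministic and a probabilistic half, which meet in the operator norms of the noise blocks `W₁₁`
and `W₁₂`.

*Deterministic half.* Let `Q = P₁₁`, a block of the same rank `K` as the symmetric matrix `P`.
Then `P₁₂ = Q B` and `P₂₂ = Bᵀ Q B` for some `B` (`exists_toBlocks_eq_of_isSymm`), and `B` can be
chosen with `‖B‖ ≤ ‖P₁₂‖_F / s`, where `s = n p / ψ` bounds the nonzero singular values of `Q`
from below. If `T` is the truncated decomposition of `A₁₁` and `X` its Moore–Penrose inverse, the
error of the estimate of `P₂₂` is `Bᵀ (Q X Q - Q) B + W₁₂ᵀ X P₁₂ + P₁₂ᵀ X W₁₂ + W₁₂ᵀ X W₁₂`. Since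
`T X` and `X T` are orthogonal projections, `Q X Q - Q` is of the size of `T - Q`, which by
Eckart–Young is of the size of `W₁₁`; by Weyl's inequality `‖X‖ ≤ 2 / s` once `‖W₁₁‖ ≤ s / 2`. All
matrices involved have rank at most `2 K`, so passing to Frobenius norms costs a factor of order
`√K` (`frobNorm_leOutput_sub_le`). The observed blocks are covered by Eckart–Young alone, and
symmetrization and clipping do not increase Frobenius distances
(`IsFullEstimate.frobNorm_sub_le`).

*Probabilistic half.* It remains to show `‖W₁₁‖ = O(√(n p))` and `‖W₁₂‖ = O(√(N p))` down to
expected degrees `n p` of order `log n`; the matrix Bernstein inequality would lose a logarithm.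
The strict upper triangle of the noise has independent centred entries, and the trace method is
applied to it in the form of a comparison argument in the spirit of Bandeira and van Handel. The
expectation of `tr (W Wᵀ)ᵏ` is a sum over closed bipartite walks; a walk contributes at most
`p ^ (number of edges)`, nothing if some edge is traversed once only, and the number of edges is at
least the number of vertices minus one. Counting walks by the pattern of coincidences among their
vertices, the sum is at most `1 / p` times the same sum for a dense random matrix whose size
`2 k + 1` is of the order of the expected degree, provided its centred entries have moments at least
one (`sum_pow_card_image_mul_le`, `mul_integral_trace_le`). The norm of the dense matrix is
controlled by a net consisting of integer points and the subgaussian moment generating function of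
its entries (`sum_trace_refMatrix_le`). Markov's inequality with `k` of order `n p + log n` or
`N p + log n` concludes (`exists_opNorm_le`).
-/

noncomputable section

namespace Egocentric

open scoped Matrix.Norms.L2Operator
open WithLp (toLp)

section

variable {α β γ : Type*} [Fintype α] [Fintype β] [Fintype γ]

/-! ### Frobenius and operator norms -/

lemma norm_toLp_mulVec_le [DecidableEq β] (A : Matrix α β ℝ) (x : β → ℝ) :
    ‖toLp 2 (A *ᵥ x)‖ ≤ ‖A‖ * ‖toLp 2 x‖ := by
  have := Matrix.l2_opNorm_mulVec A (toLp 2 x)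
  simpa using this

lemma opNorm_le_of_mulVec [DecidableEq β] (A : Matrix α β ℝ) {C : ℝ} (hC : 0 ≤ C)
    (h : ∀ x : β → ℝ, ‖toLp 2 (A *ᵥ x)‖ ≤ C * ‖toLp 2 x‖) : ‖A‖ ≤ C := by
  rw [Matrix.l2_opNorm_def]
  refine ContinuousLinearMap.opNorm_le_bound _ hC fun x => ?_
  exact h x.ofLp

lemma norm_toLp_sq (x : α → ℝ) : ‖toLp 2 x‖ ^ 2 = ∑ i, x i ^ 2 := by
  rw [EuclideanSpace.norm_sq_eq]; simp

lemma opNorm_transpose [DecidableEq α] [DecidableEq β] (A : Matrix α β ℝ) : ‖Aᵀ‖ = ‖A‖ := by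
  rw [← Matrix.conjTranspose_eq_transpose_of_trivial, Matrix.l2_opNorm_conjTranspose]

lemma frobNorm_eq_norm (M : Matrix α β ℝ) :
    frobNorm M = ‖toLp 2 (fun e : α × β => M e.1 e.2)‖ := by
  rw [EuclideanSpace.norm_eq, frobNorm, Fintype.sum_prod_type]; simp

lemma frobNorm_nonneg (M : Matrix α β ℝ) : 0 ≤ frobNorm M := Real.sqrt_nonneg _

lemma frobNorm_sq (M : Matrix α β ℝ) : frobNorm M ^ 2 = ∑ i, ∑ j, M i j ^ 2 :=
  Real.sq_sqrt (by positivity)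

lemma frobNorm_add_le (M M' : Matrix α β ℝ) : frobNorm (M + M') ≤ frobNorm M + frobNorm M' := by
  simp only [frobNorm_eq_norm]
  exact norm_add_le (toLp 2 (fun e : α × β => M e.1 e.2)) (toLp 2 (fun e : α × β => M' e.1 e.2))

lemma frobNorm_neg (M : Matrix α β ℝ) : frobNorm (-M) = frobNorm M := by
  simp [frobNorm]

lemma frobNorm_smul (c : ℝ) (M : Matrix α β ℝ) : frobNorm (c • M) = |c| * frobNorm M := by
  simp only [frobNorm_eq_norm]
  exact norm_smul c (toLp 2 (fun e : α × β => M e.1 e.2))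

lemma frobNorm_sub_le (M M' : Matrix α β ℝ) : frobNorm (M - M') ≤ frobNorm M + frobNorm M' := by
  rw [sub_eq_add_neg, ← frobNorm_neg M']; exact frobNorm_add_le _ _

lemma frobNorm_transpose (M : Matrix α β ℝ) : frobNorm Mᵀ = frobNorm M := by
  simp only [frobNorm, transpose_apply]; rw [Finset.sum_comm]

lemma frobNorm_mono {M M' : Matrix α β ℝ} (h : ∀ i j, |M i j| ≤ |M' i j|) :
    frobNorm M ≤ frobNorm M' :=
  Real.sqrt_le_sqrt (Finset.sum_le_sum fun i _ => Finset.sum_le_sum fun j _ => sq_le_sq.2 (h i j))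

lemma frobNorm_sq_eq_sum_col (M : Matrix α β ℝ) :
    frobNorm M ^ 2 = ∑ j, ‖toLp 2 (M.col j)‖ ^ 2 := by
  rw [frobNorm_sq, Finset.sum_comm]; simp [norm_toLp_sq, Matrix.col]

lemma frobNorm_mul_le [DecidableEq β] (A : Matrix α β ℝ) (B : Matrix β γ ℝ) :
    frobNorm (A * B) ≤ ‖A‖ * frobNorm B := by
  refine abs_le_of_sq_le_sq' ?_ (mul_nonneg (norm_nonneg _) (frobNorm_nonneg _)) |>.2
  rw [mul_pow, frobNorm_sq_eq_sum_col, frobNorm_sq_eq_sum_col, Finset.mul_sum]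
  refine Finset.sum_le_sum fun j _ => ?_
  rw [← mul_pow]
  have : (A * B).col j = A *ᵥ B.col j := by
    ext i; simp [Matrix.mul_apply, Matrix.mulVec, dotProduct]
  rw [this]
  gcongr
  exact norm_toLp_mulVec_le A _

lemma frobNorm_mul_le' [DecidableEq α] [DecidableEq β] [DecidableEq γ] (A : Matrix α β ℝ)
    (B : Matrix β γ ℝ) : frobNorm (A * B) ≤ frobNorm A * ‖B‖ := by
  rw [← frobNorm_transpose, transpose_mul, ← frobNorm_transpose A, ← opNorm_transpose B, mul_comm]
  exact frobNorm_mul_le _ _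

lemma opNorm_le_frobNorm [DecidableEq β] (A : Matrix α β ℝ) : ‖A‖ ≤ frobNorm A := by
  refine opNorm_le_of_mulVec A (frobNorm_nonneg A) fun x => ?_
  refine abs_le_of_sq_le_sq' ?_ (mul_nonneg (frobNorm_nonneg _) (norm_nonneg _)) |>.2
  rw [mul_pow, frobNorm_sq, norm_toLp_sq, norm_toLp_sq, Finset.sum_mul]
  exact Finset.sum_le_sum fun i _ => Finset.sum_mul_sq_le_sq_mul_sq _ _ _

/-- Expanding the columns in an orthonormal basis of the range, which has `rank M` elements. -/
lemma frobNorm_le_sqrt_rank_mul [DecidableEq α] [DecidableEq β] (M : Matrix α β ℝ) {r : ℕ}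
    (hr : M.rank ≤ r) : frobNorm M ≤ Real.sqrt r * ‖M‖ := by
  refine abs_le_of_sq_le_sq' ?_ (by positivity) |>.2
  rw [mul_pow, Real.sq_sqrt (by positivity)]
  set S := LinearMap.range (Matrix.toLpLin 2 2 M) with hS
  have hfin : Module.finrank ℝ S = M.rank := by
    rw [hS, Matrix.toLpLin_eq_toLin, ← Matrix.rank_eq_finrank_range_toLin]
  let b := stdOrthonormalBasis ℝ S
  have hcol : ∀ j, ‖toLp 2 (M.col j)‖ ^ 2 = ∑ k, (Mᵀ *ᵥ (b k : EuclideanSpace ℝ α).ofLp) j ^ 2 := by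
    intro j
    have hmem : toLp 2 (M.col j) ∈ S := ⟨toLp 2 (Pi.single j 1), by
      rw [Matrix.toLpLin_toLp, Matrix.toLin'_apply, Matrix.mulVec_single_one]⟩
    have := b.sum_sq_norm_inner_right ⟨_, hmem⟩
    have h2 : ‖(⟨toLp 2 (M.col j), hmem⟩ : S)‖ = ‖toLp 2 (M.col j)‖ := rfl
    rw [h2] at this
    rw [← this]
    refine Finset.sum_congr rfl fun k _ => ?_
    rw [Submodule.coe_inner, Real.norm_eq_abs, sq_abs, PiLp.inner_apply]
    simp [Matrix.mulVec, dotProduct, Matrix.col]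
  rw [frobNorm_sq_eq_sum_col]
  simp_rw [hcol]
  rw [Finset.sum_comm]
  calc ∑ k, ∑ j, (Mᵀ *ᵥ (b k : EuclideanSpace ℝ α).ofLp) j ^ 2
      ≤ ∑ k : Fin (Module.finrank ℝ S), ‖M‖ ^ 2 := by
        refine Finset.sum_le_sum fun k _ => ?_
        rw [← norm_toLp_sq, ← opNorm_transpose M]
        have h1 := norm_toLp_mulVec_le Mᵀ (b k : EuclideanSpace ℝ α).ofLp
        have h2 : ‖(b k : EuclideanSpace ℝ α)‖ = 1 := by
          exact b.orthonormal.1 k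
        rw [WithLp.toLp_ofLp, h2, mul_one] at h1
        gcongr
    _ ≤ r * ‖M‖ ^ 2 := by
        rw [Finset.sum_const, Finset.card_univ, Fintype.card_fin, nsmul_eq_mul]
        gcongr
        exact_mod_cast hfin ▸ hr

end

section

variable {α β γ : Type*} [Fintype α] [Fintype β] [Fintype γ]
  [DecidableEq α] [DecidableEq β] [DecidableEq γ]

/-! ### Truncated singular value decompositions -/

omit [DecidableEq α] in
lemma norm_toLp_mulVec_of_orthonormal {U : Matrix α β ℝ} (hU : Uᵀ * U = 1) (x : β → ℝ) :
    ‖toLp 2 (U *ᵥ x)‖ = ‖toLp 2 x‖ := by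
  have h : ‖toLp 2 (U *ᵥ x)‖ ^ 2 = ‖toLp 2 x‖ ^ 2 := by
    have e : ∀ {ι : Type _} [Fintype ι] (y : ι → ℝ), ‖toLp 2 y‖ ^ 2 = y ⬝ᵥ y := by
      intro ι _ y; rw [norm_toLp_sq]; simp [dotProduct, sq]
    rw [e, norm_toLp_sq, Matrix.dotProduct_mulVec, Matrix.vecMul_mulVec, hU, Matrix.vecMul_one]
    simp [dotProduct, sq]
  exact (sq_eq_sq₀ (norm_nonneg _) (norm_nonneg _)).1 h

omit [DecidableEq α] in
lemma opNorm_le_one_of_orthonormal {U : Matrix α β ℝ} (hU : Uᵀ * U = 1) : ‖U‖ ≤ 1 :=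
  opNorm_le_of_mulVec U zero_le_one fun x => by
    rw [norm_toLp_mulVec_of_orthonormal hU, one_mul]

omit [Fintype α] [DecidableEq α] [DecidableEq β] in
lemma exists_mulVec_eq_zero_of_rank_lt {M : Matrix α β ℝ} (h : M.rank < Fintype.card β) :
    ∃ x : β → ℝ, x ≠ 0 ∧ M *ᵥ x = 0 := by
  have h1 := LinearMap.finrank_range_add_finrank_ker M.mulVecLin
  rw [Module.finrank_fintype_fun_eq_card] at h1
  have h2 : 0 < Module.finrank ℝ (LinearMap.ker M.mulVecLin) := by
    have : M.rank = Module.finrank ℝ (LinearMap.range M.mulVecLin) := rfl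
    omega
  obtain ⟨x, hx, hx0⟩ := Submodule.exists_mem_ne_zero_of_ne_bot
    (p := LinearMap.ker M.mulVecLin) (by rintro h0; rw [h0, finrank_bot] at h2; exact h2.false)
  exact ⟨x, hx0, by simpa using hx⟩

lemma opNorm_diagonal_le {d : α → ℝ} {c : ℝ} (hc : 0 ≤ c) (h : ∀ k, |d k| ≤ c) :
    ‖(Matrix.diagonal d : Matrix α α ℝ)‖ ≤ c := by
  rw [Matrix.l2_opNorm_diagonal]
  exact (pi_norm_le_iff_of_nonneg hc).2 h

omit [DecidableEq α] in
lemma opNorm_orthonormal_mul_diagonal_mul_le {U : Matrix α γ ℝ} {V : Matrix β γ ℝ}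
    (hU : Uᵀ * U = 1) (hV : Vᵀ * V = 1) {d : γ → ℝ} {c : ℝ} (hc : 0 ≤ c) (h : ∀ k, |d k| ≤ c) :
    ‖U * Matrix.diagonal d * Vᵀ‖ ≤ c := by
  calc ‖U * Matrix.diagonal d * Vᵀ‖ ≤ ‖U * Matrix.diagonal d‖ * ‖Vᵀ‖ := Matrix.l2_opNorm_mul _ _
    _ ≤ (‖U‖ * ‖Matrix.diagonal d‖) * ‖Vᵀ‖ := by gcongr; exact Matrix.l2_opNorm_mul _ _
    _ ≤ (1 * c) * 1 := by
        gcongr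
        · exact opNorm_le_one_of_orthonormal hU
        · exact opNorm_diagonal_le hc h
        · rw [opNorm_transpose]; exact opNorm_le_one_of_orthonormal hV
    _ = c := by ring

omit [DecidableEq α] in
/-- Upper half of the Eckart–Young–Mirsky theorem: beyond the `K`-th one, the singular values of
`M` are at most the distance from `M` to any matrix of rank at most `K`. -/
lemma IsSVD.le_opNorm_sub {M B : Matrix α β ℝ} {U d V} (h : IsSVD M U d V) {K : ℕ}
    (hB : B.rank ≤ K) (k : Fin (min (Fintype.card α) (Fintype.card β))) (hk : K ≤ k) :
    d k ≤ ‖M - B‖ := by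
  classical
  set J : Matrix (Fin (min (Fintype.card α) (Fintype.card β))) (Fin (k + 1)) ℝ :=
    (1 : Matrix _ _ ℝ).submatrix id (Fin.castLE k.2) with hJ
  have hJJ : Jᵀ * J = 1 := by
    ext i j
    simp [hJ, Matrix.mul_apply, Matrix.one_apply]
  -- The span of the first `k + 1` right singular vectors meets the kernel of `B`, whose
  -- codimension is at most `K ≤ k`.
  obtain ⟨c, hc0, hc⟩ := exists_mulVec_eq_zero_of_rank_lt (M := B * (V * J)) (by
    refine lt_of_le_of_lt (Matrix.rank_mul_le_left _ _) ?_
    simp only [Fintype.card_fin]; omega)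
  have hVJ : (V * J)ᵀ * (V * J) = 1 := by
    rw [Matrix.transpose_mul, Matrix.mul_assoc, ← Matrix.mul_assoc Vᵀ, h.orthonormal_right,
      Matrix.one_mul, hJJ]
  have hx : ‖toLp 2 ((V * J) *ᵥ c)‖ = ‖toLp 2 c‖ := norm_toLp_mulVec_of_orthonormal hVJ c
  have hcpos : 0 < ‖toLp 2 c‖ := norm_pos_iff.2 (by simpa using hc0)
  have hMB : (M - B) *ᵥ ((V * J) *ᵥ c) = U *ᵥ (Matrix.diagonal d *ᵥ (J *ᵥ c)) := by
    rw [Matrix.sub_mulVec, Matrix.mulVec_mulVec _ B, hc, sub_zero, h.eq_mul]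
    simp only [Matrix.mulVec_mulVec, Matrix.mul_assoc]
    rw [← Matrix.mul_assoc Vᵀ, h.orthonormal_right, Matrix.one_mul]
  have hJc : ∀ i, d k ^ 2 * (J *ᵥ c) i ^ 2 ≤ (d i * (J *ᵥ c) i) ^ 2 := by
    intro i
    rw [mul_pow]
    by_cases hi : i ≤ k
    · have := h.antitone hi
      have := h.nonneg k
      gcongr
    · have : (J *ᵥ c) i = 0 := by
        simp only [hJ, Matrix.mulVec, dotProduct, Matrix.submatrix_apply, id, Matrix.one_apply]
        refine Finset.sum_eq_zero fun j _ => ?_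
        rw [if_neg, zero_mul]
        rintro rfl
        exact hi (Fin.mk_le_of_le_val (Nat.lt_succ_iff.1 j.2))
      simp [this]
  have key : d k * ‖toLp 2 c‖ ≤ ‖M - B‖ * ‖toLp 2 c‖ := by
    calc d k * ‖toLp 2 c‖ = d k * ‖toLp 2 (J *ᵥ c)‖ := by
          rw [norm_toLp_mulVec_of_orthonormal hJJ]
      _ ≤ ‖toLp 2 (Matrix.diagonal d *ᵥ (J *ᵥ c))‖ := by
          refine abs_le_of_sq_le_sq' ?_ (norm_nonneg _) |>.2
          rw [mul_pow, norm_toLp_sq, norm_toLp_sq, Finset.mul_sum]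
          exact Finset.sum_le_sum fun i _ => by rw [Matrix.mulVec_diagonal]; exact hJc i
      _ = ‖toLp 2 ((M - B) *ᵥ ((V * J) *ᵥ c))‖ := by
          rw [hMB, norm_toLp_mulVec_of_orthonormal h.orthonormal_left]
      _ ≤ ‖M - B‖ * ‖toLp 2 c‖ := by
          rw [← hx]; exact norm_toLp_mulVec_le _ _
  exact le_of_mul_le_mul_right key hcpos

omit [DecidableEq α] in
lemma IsTruncatedSVD.opNorm_sub_le {M T B : Matrix α β ℝ} {K : ℕ} (h : IsTruncatedSVD K M T)
    (hB : B.rank ≤ K) : ‖M - T‖ ≤ ‖M - B‖ := by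
  obtain ⟨U, d, V, hs, rfl⟩ := h
  nth_rw 1 [hs.eq_mul]
  rw [← Matrix.sub_mul, ← Matrix.mul_sub, Matrix.diagonal_sub]
  refine opNorm_orthonormal_mul_diagonal_mul_le hs.orthonormal_left hs.orthonormal_right
    (norm_nonneg _) fun k => ?_
  split_ifs with hk
  · simp
  · rw [sub_zero, abs_of_nonneg (hs.nonneg k)]
    exact hs.le_opNorm_sub hB k (not_lt.1 hk)

omit [DecidableEq α] [DecidableEq β] in
lemma IsTruncatedSVD.rank_le {M T : Matrix α β ℝ} {K : ℕ} (h : IsTruncatedSVD K M T) :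
    T.rank ≤ K := by
  obtain ⟨U, d, V, hs, rfl⟩ := h
  refine (Matrix.rank_mul_le_left _ _).trans ((Matrix.rank_mul_le_right _ _).trans ?_)
  rw [Matrix.rank_diagonal]
  refine (Fintype.card_le_of_injective (fun i => (⟨i.1, ?_⟩ : Fin K)) ?_).trans_eq
    (Fintype.card_fin K)
  · by_contra hi
    exact i.2 (if_neg hi)
  · intro i j hij
    exact Subtype.ext (Fin.ext (by simpa using hij))

omit [Fintype α] [DecidableEq α] [DecidableEq β] in
lemma rank_add_le (A B : Matrix α β ℝ) : (A + B).rank ≤ A.rank + B.rank := by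
  unfold Matrix.rank
  rw [Matrix.mulVecLin_add]
  refine (Submodule.finrank_mono (LinearMap.range_add_le _ _)).trans
    (Submodule.finrank_add_le_finrank_add_finrank _ _)

omit [DecidableEq β] in
lemma rank_sub_le (A B : Matrix α β ℝ) : (A - B).rank ≤ A.rank + B.rank := by
  have : (-B).rank ≤ B.rank := by
    have := Matrix.rank_mul_le_right (-1 : Matrix α α ℝ) B
    simpa using this
  rw [sub_eq_add_neg]
  exact (rank_add_le A (-B)).trans (by omega)

omit [DecidableEq α] in
lemma IsTruncatedSVD.opNorm_sub_le_two_mul {M T B : Matrix α β ℝ} {K : ℕ}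
    (h : IsTruncatedSVD K M T) (hB : B.rank ≤ K) : ‖T - B‖ ≤ 2 * ‖M - B‖ := by
  have h1 : T - B = (M - B) - (M - T) := by abel
  rw [h1, two_mul]
  exact (norm_sub_le _ _).trans (by gcongr; exact h.opNorm_sub_le hB)

lemma IsTruncatedSVD.frobNorm_sub_le {M T B : Matrix α β ℝ} {K : ℕ}
    (h : IsTruncatedSVD K M T) (hB : B.rank ≤ K) :
    frobNorm (T - B) ≤ 4 * Real.sqrt K * ‖M - B‖ := by
  -- The rank is at most `2 * K`; the weaker bound makes the square root come out even.
  have hr : (T - B).rank ≤ 4 * K := by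
    have := rank_sub_le T B
    have := h.rank_le
    omega
  refine (frobNorm_le_sqrt_rank_mul _ hr).trans ?_
  have h4 : Real.sqrt ((4 * K : ℕ) : ℝ) = 2 * Real.sqrt K := by
    rw [Nat.cast_mul, Real.sqrt_mul (by positivity)]
    congr 1
    rw [show ((4 : ℕ) : ℝ) = 2 ^ 2 by norm_num, Real.sqrt_sq (by norm_num)]
  rw [h4]
  calc 2 * Real.sqrt K * ‖T - B‖ ≤ 2 * Real.sqrt K * (2 * ‖M - B‖) := by
        gcongr; exact h.opNorm_sub_le_two_mul hB
    _ = _ := by ring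

/-! ### Moore–Penrose inverses -/

omit [DecidableEq α] [DecidableEq β] in
lemma IsMoorePenrose.unique {M : Matrix α β ℝ} {X Y : Matrix β α ℝ}
    (hX : IsMoorePenrose M X) (hY : IsMoorePenrose M Y) : X = Y := by
  have h1 : M * X = M * Y := by
    have : (M * X)ᵀ = (M * Y * (M * X))ᵀ := by
      rw [← Matrix.mul_assoc, hY.mul_mul_self]
    rw [Matrix.transpose_mul (M * Y), hX.symm_left.eq, hY.symm_left.eq, ← Matrix.mul_assoc,
      hX.mul_mul_self] at this
    exact this
  have h2 : X * M = Y * M := by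
    have : (X * M)ᵀ = (X * M * (Y * M))ᵀ := by
      rw [Matrix.mul_assoc, ← Matrix.mul_assoc M, hY.mul_mul_self]
    rw [Matrix.transpose_mul (X * M), hX.symm_right.eq, hY.symm_right.eq, Matrix.mul_assoc,
      ← Matrix.mul_assoc M, hX.mul_mul_self] at this
    exact this
  rw [← hX.self_mul_mul, h2, Matrix.mul_assoc, h1, ← Matrix.mul_assoc, hY.self_mul_mul]

lemma opNorm_le_one_of_isSymm_of_idempotent {Q : Matrix α α ℝ} (hs : Q.IsSymm) (hi : Q * Q = Q) :
    ‖Q‖ ≤ 1 := by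
  have h := Matrix.l2_opNorm_conjTranspose_mul_self Q
  rw [Matrix.conjTranspose_eq_transpose_of_trivial, hs.eq, hi] at h
  nlinarith [norm_nonneg Q]

omit [DecidableEq β] in
lemma IsMoorePenrose.opNorm_mul_le_one {M : Matrix α β ℝ} {X : Matrix β α ℝ}
    (h : IsMoorePenrose M X) : ‖M * X‖ ≤ 1 :=
  opNorm_le_one_of_isSymm_of_idempotent h.symm_left (by
    rw [← Matrix.mul_assoc, h.mul_mul_self])

omit [DecidableEq α] in
lemma IsMoorePenrose.opNorm_mul_le_one' {M : Matrix α β ℝ} {X : Matrix β α ℝ}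
    (h : IsMoorePenrose M X) : ‖X * M‖ ≤ 1 :=
  opNorm_le_one_of_isSymm_of_idempotent h.symm_right (by
    rw [← Matrix.mul_assoc, h.self_mul_mul])

omit [DecidableEq α] [DecidableEq β] in
lemma IsMoorePenrose.rank_le {M : Matrix α β ℝ} {X : Matrix β α ℝ}
    (h : IsMoorePenrose M X) : X.rank ≤ M.rank := by
  rw [← h.self_mul_mul]
  exact (Matrix.rank_mul_le_left _ _).trans (Matrix.rank_mul_le_right _ _)

omit [DecidableEq α] [DecidableEq β] in
/-- The Moore–Penrose inverse of a matrix given by a thin singular value decomposition. -/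
lemma isMoorePenrose_orthonormal_mul_diagonal_mul {U : Matrix α γ ℝ} {V : Matrix β γ ℝ}
    (hU : Uᵀ * U = 1) (hV : Vᵀ * V = 1) (d : γ → ℝ) :
    IsMoorePenrose (U * Matrix.diagonal d * Vᵀ) (V * Matrix.diagonal (fun k => (d k)⁻¹) * Uᵀ) := by
  have e1 : ∀ (a b : γ → ℝ), U * Matrix.diagonal a * Vᵀ * (V * Matrix.diagonal b * Uᵀ)
      = U * Matrix.diagonal (fun k => a k * b k) * Uᵀ := by
    intro a b
    rw [Matrix.mul_assoc (U * _), ← Matrix.mul_assoc Vᵀ, ← Matrix.mul_assoc Vᵀ, hV, Matrix.one_mul,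
      ← Matrix.mul_assoc, Matrix.mul_assoc U, Matrix.diagonal_mul_diagonal]
  have e2 : ∀ (a b : γ → ℝ), V * Matrix.diagonal b * Uᵀ * (U * Matrix.diagonal a * Vᵀ)
      = V * Matrix.diagonal (fun k => b k * a k) * Vᵀ := by
    intro a b
    rw [Matrix.mul_assoc (V * _), ← Matrix.mul_assoc Uᵀ, ← Matrix.mul_assoc Uᵀ, hU, Matrix.one_mul,
      ← Matrix.mul_assoc, Matrix.mul_assoc V, Matrix.diagonal_mul_diagonal]
  have e3 : ∀ (a b : γ → ℝ), U * Matrix.diagonal a * Uᵀ * (U * Matrix.diagonal b * Vᵀ)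
      = U * Matrix.diagonal (fun k => a k * b k) * Vᵀ := by
    intro a b
    rw [Matrix.mul_assoc (U * _), ← Matrix.mul_assoc Uᵀ, ← Matrix.mul_assoc Uᵀ, hU, Matrix.one_mul,
      ← Matrix.mul_assoc, Matrix.mul_assoc U, Matrix.diagonal_mul_diagonal]
  have e4 : ∀ (a b : γ → ℝ), V * Matrix.diagonal a * Vᵀ * (V * Matrix.diagonal b * Uᵀ)
      = V * Matrix.diagonal (fun k => a k * b k) * Uᵀ := by
    intro a b
    rw [Matrix.mul_assoc (V * _), ← Matrix.mul_assoc Vᵀ, ← Matrix.mul_assoc Vᵀ, hV, Matrix.one_mul,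
      ← Matrix.mul_assoc, Matrix.mul_assoc V, Matrix.diagonal_mul_diagonal]
  refine ⟨?_, ?_, ?_, ?_⟩
  · rw [e1, e3]; simp only [mul_inv_mul_cancel]
  · rw [e2, e4]
    simp only [fun k => show (d k)⁻¹ * d k * (d k)⁻¹ = (d k)⁻¹ by
      simpa using mul_inv_mul_cancel (d k)⁻¹]
  · rw [e1, Matrix.IsSymm]
    simp [Matrix.transpose_mul, Matrix.mul_assoc]
  · rw [e2, Matrix.IsSymm]
    simp [Matrix.transpose_mul, Matrix.mul_assoc]

/-! ### Perturbation of the smallest nonzero singular value -/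

omit [DecidableEq α] in
/-- Weyl's inequality: if all nonzero singular values of `B` are at least `s`, then the first
`rank B` singular values of `M` are at least `s - ‖M - B‖`. -/
lemma IsSVD.le_add_opNorm_sub {M B : Matrix α β ℝ} {U d V} (h : IsSVD M U d V) {s : ℝ}
    (hs : ∀ x ∈ (LinearMap.ker (Matrix.toLpLin 2 2 B))ᗮ, s * ‖x‖ ≤ ‖Matrix.toLpLin 2 2 B x‖)
    (k : Fin (min (Fintype.card α) (Fintype.card β))) (hk : (k : ℕ) < B.rank) :
    s ≤ d k + ‖M - B‖ := by
  set S := (LinearMap.ker (Matrix.toLpLin 2 2 B))ᗮ with hS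
  have hfin : Module.finrank ℝ S = B.rank := by
    have h1 := Submodule.finrank_add_finrank_orthogonal (LinearMap.ker (Matrix.toLpLin 2 2 B))
    have h2 := LinearMap.finrank_range_add_finrank_ker (Matrix.toLpLin 2 2 B)
    rw [Matrix.toLpLin_eq_toLin, ← Matrix.rank_eq_finrank_range_toLin,
      ← Matrix.toLpLin_eq_toLin] at h2
    rw [hS]; omega
  -- Some vector of `S` is orthogonal to the first `k` right singular vectors, as `k < dim S`.
  let f : S →ₗ[ℝ] (Fin k → ℝ) :=
    LinearMap.funLeft ℝ ℝ (Fin.castLE k.2.le) ∘ₗ Vᵀ.mulVecLin ∘ₗ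
      (WithLp.linearEquiv 2 ℝ (β → ℝ)).toLinearMap ∘ₗ S.subtype
  have hker : LinearMap.ker f ≠ ⊥ := LinearMap.ker_ne_bot_of_finrank_lt (by
    rw [hfin, Module.finrank_fintype_fun_eq_card, Fintype.card_fin]; exact hk)
  obtain ⟨⟨x, hxS⟩, hx, hx0⟩ := Submodule.exists_mem_ne_zero_of_ne_bot hker
  have hx0' : x ≠ 0 := fun h0 => hx0 (Subtype.ext h0)
  have hV : ∀ i, i < k → (Vᵀ *ᵥ x.ofLp) i = 0 := by
    intro i hi
    have := congrFun (LinearMap.mem_ker.1 hx) ⟨i, hi⟩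
    exact this
  have hMx : ‖toLp 2 (M *ᵥ x.ofLp)‖ ≤ d k * ‖x‖ := by
    rw [h.eq_mul, ← Matrix.mulVec_mulVec, ← Matrix.mulVec_mulVec,
      norm_toLp_mulVec_of_orthonormal h.orthonormal_left]
    calc ‖toLp 2 (Matrix.diagonal d *ᵥ (Vᵀ *ᵥ x.ofLp))‖ ≤ d k * ‖toLp 2 (Vᵀ *ᵥ x.ofLp)‖ := by
          refine abs_le_of_sq_le_sq' ?_ (mul_nonneg (h.nonneg k) (norm_nonneg _)) |>.2
          rw [mul_pow, norm_toLp_sq, norm_toLp_sq, Finset.mul_sum]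
          refine Finset.sum_le_sum fun i _ => ?_
          rw [Matrix.mulVec_diagonal]
          rcases lt_or_ge i k with hi | hi
          · simp [hV i hi]
          · rw [mul_pow]
            have := h.antitone hi
            have := h.nonneg i
            gcongr
      _ ≤ d k * (‖Vᵀ‖ * ‖x‖) := by
          gcongr
          · exact h.nonneg k
          · exact norm_toLp_mulVec_le _ _
      _ ≤ d k * (1 * ‖x‖) := by
          gcongr
          · exact h.nonneg k
          · rw [opNorm_transpose]; exact opNorm_le_one_of_orthonormal h.orthonormal_right
      _ = d k * ‖x‖ := by ring
  have hpos : 0 < ‖x‖ := norm_pos_iff.2 hx0'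
  refine le_of_mul_le_mul_right ?_ hpos
  calc s * ‖x‖ ≤ ‖Matrix.toLpLin 2 2 B x‖ := hs x hxS
    _ = ‖toLp 2 (M *ᵥ x.ofLp) - toLp 2 ((M - B) *ᵥ x.ofLp)‖ := by
        rw [← WithLp.toLp_sub, Matrix.sub_mulVec, sub_sub_cancel]; rfl
    _ ≤ ‖toLp 2 (M *ᵥ x.ofLp)‖ + ‖toLp 2 ((M - B) *ᵥ x.ofLp)‖ := norm_sub_le _ _
    _ ≤ d k * ‖x‖ + ‖M - B‖ * ‖x‖ := by
        gcongr
        exact norm_toLp_mulVec_le _ _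
    _ = (d k + ‖M - B‖) * ‖x‖ := by ring

/-- If all nonzero singular values of `B` are at least `s` and `A` is close to `B`, then the
Moore–Penrose inverse of a rank-`K` truncation of `A` is bounded, `K` being the rank of `B`. -/
lemma opNorm_moorePenrose_le {A B T : Matrix α β ℝ} {X : Matrix β α ℝ} {s : ℝ} (hs0 : 0 < s)
    (hs : ∀ x ∈ (LinearMap.ker (Matrix.toLpLin 2 2 B))ᗮ, s * ‖x‖ ≤ ‖Matrix.toLpLin 2 2 B x‖)
    (hT : IsTruncatedSVD B.rank A T) (hX : IsMoorePenrose T X) (hAB : ‖A - B‖ ≤ s / 2) :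
    ‖X‖ ≤ 2 / s := by
  obtain ⟨U, d, V, hsvd, rfl⟩ := hT
  rw [hX.unique (isMoorePenrose_orthonormal_mul_diagonal_mul hsvd.orthonormal_left
    hsvd.orthonormal_right _)]
  refine opNorm_orthonormal_mul_diagonal_mul_le hsvd.orthonormal_right hsvd.orthonormal_left
    (by positivity) fun k => ?_
  split_ifs with hk
  · have := hsvd.le_add_opNorm_sub hs k hk
    have h2 : s / 2 ≤ d k := by linarith
    rw [abs_inv, abs_of_nonneg (hsvd.nonneg k), ← inv_div]
    exact inv_anti₀ (by positivity) h2
  · simp; positivity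

/-- On the orthogonal complement of its kernel a linear map expands by at least its smallest
nonzero singular value. -/
lemma singularValues_mul_norm_le {E F : Type*} [NormedAddCommGroup E] [InnerProductSpace ℝ E]
    [FiniteDimensional ℝ E] [NormedAddCommGroup F] [InnerProductSpace ℝ F] [FiniteDimensional ℝ F]
    (T : E →ₗ[ℝ] F) {x : E} (hx : x ∈ (LinearMap.ker T)ᗮ) :
    T.singularValues (Module.finrank ℝ (LinearMap.range T) - 1) * ‖x‖ ≤ ‖T x‖ := by
  set K := Module.finrank ℝ (LinearMap.range T) with hK
  have hT := T.isSymmetric_adjoint_comp_self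
  let b := hT.eigenvectorBasis rfl
  have hb : ∀ i, ‖T (b i)‖ ^ 2 = T.singularValues i ^ 2 := by
    intro i
    rw [T.sq_singularValues_fin rfl, ← real_inner_self_eq_norm_sq, ← LinearMap.adjoint_inner_left,
      ← LinearMap.comp_apply, hT.apply_eigenvectorBasis rfl i]
    rw [inner_smul_left, real_inner_self_eq_norm_sq]
    simp
  have hzero : ∀ i : Fin (Module.finrank ℝ E), K ≤ i → b.repr x i = 0 := by
    intro i hi
    have h0 : T (b i) = 0 := by
      have := hb i
      rw [(T.singularValues_eq_zero_iff_le_finrank_range).2 hi] at this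
      simpa using this
    rw [b.repr_apply_apply]
    exact hx (b i) h0
  have hTx : ‖T x‖ ^ 2 =
      ∑ i : Fin (Module.finrank ℝ E), T.singularValues i ^ 2 * b.repr x i ^ 2 := by
    rw [← real_inner_self_eq_norm_sq, ← LinearMap.adjoint_inner_left, ← LinearMap.comp_apply,
      ← b.sum_inner_mul_inner]
    refine Finset.sum_congr rfl fun i _ => ?_
    rw [hT, hT.apply_eigenvectorBasis rfl i, inner_smul_right, T.sq_singularValues_fin rfl,
      b.repr_apply_apply, real_inner_comm (b i) x]
    simp [b, sq, mul_assoc]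
  have hxx : ‖x‖ ^ 2 = ∑ i, b.repr x i ^ 2 := by
    rw [← b.repr.norm_map x, EuclideanSpace.norm_sq_eq]; simp
  refine abs_le_of_sq_le_sq' ?_ (norm_nonneg _) |>.2
  rw [mul_pow, hTx, hxx, Finset.mul_sum]
  refine Finset.sum_le_sum fun i _ => ?_
  rcases lt_or_ge (i : ℕ) K with hi | hi
  · have h1 := T.singularValues_antitone (show (i : ℕ) ≤ K - 1 by omega)
    have h2 := T.singularValues_nonneg (K - 1)
    gcongr
  · simp [hzero i hi]

end

section

variable {α β γ : Type*} [Fintype α] [Fintype β] [Fintype γ]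
  [DecidableEq α] [DecidableEq β] [DecidableEq γ]

/-! ### Extending the observed block by rank considerations -/

/-- If a matrix has the same rank as its leading block, the columns over that block span the column
space. -/
lemma exists_toBlocks_eq_mul {P : Matrix (α ⊕ β) (α ⊕ β) ℝ} (hP : P.rank ≤ P.toBlocks₁₁.rank) :
    ∃ B : Matrix α β ℝ, P.toBlocks₁₂ = P.toBlocks₁₁ * B ∧ P.toBlocks₂₂ = P.toBlocks₂₁ * B := by
  set C : Matrix (α ⊕ β) α ℝ := P.submatrix id Sum.inl with hC
  have hle : LinearMap.range C.mulVecLin ≤ LinearMap.range P.mulVecLin := by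
    rintro _ ⟨x, rfl⟩
    refine ⟨Sum.elim x 0, ?_⟩
    ext i
    simp [hC, Matrix.mulVec, dotProduct]
  have hrank : P.rank ≤ C.rank := by
    refine hP.trans ?_
    have : P.toBlocks₁₁ = C.submatrix Sum.inl id := rfl
    rw [this]
    exact Matrix.rank_submatrix_le _ _ _
  have heq : LinearMap.range C.mulVecLin = LinearMap.range P.mulVecLin :=
    Submodule.eq_of_le_of_finrank_le hle hrank
  have hcol : ∀ j : β, ∃ b : α → ℝ, C *ᵥ b = P.col (Sum.inr j) := by
    intro j
    have : P.col (Sum.inr j) ∈ LinearMap.range C.mulVecLin := by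
      rw [heq]
      exact ⟨Pi.single (Sum.inr j) 1, by simp⟩
    obtain ⟨b, hb⟩ := this
    exact ⟨b, hb⟩
  choose b hb using hcol
  refine ⟨(Matrix.of b)ᵀ, ?_, ?_⟩
  · ext i j
    have := congrFun (hb j) (Sum.inl i)
    simpa [hC, Matrix.mul_apply, Matrix.mulVec, dotProduct, Matrix.toBlocks₁₁, Matrix.toBlocks₁₂]
      using this.symm
  · ext i j
    have := congrFun (hb j) (Sum.inr i)
    simpa [hC, Matrix.mul_apply, Matrix.mulVec, dotProduct, Matrix.toBlocks₂₁, Matrix.toBlocks₂₂]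
      using this.symm

omit [DecidableEq α] [DecidableEq γ] in
/-- Replacing the columns of a solution `B₀` of `M * B₀ = Y` by their projections to `(ker M)ᗮ`
gives a solution controlled by the smallest nonzero singular value of `M`. -/
lemma exists_mul_eq_and_frobNorm_le {M : Matrix α β ℝ} {s : ℝ}
    (hs0 : 0 ≤ s)
    (hs : ∀ x ∈ (LinearMap.ker (Matrix.toLpLin 2 2 M))ᗮ, s * ‖x‖ ≤ ‖Matrix.toLpLin 2 2 M x‖)
    (B₀ : Matrix β γ ℝ) :
    ∃ B : Matrix β γ ℝ, M * B = M * B₀ ∧ s * frobNorm B ≤ frobNorm (M * B₀) := by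
  have hcol : ∀ j, ∃ b : β → ℝ, M *ᵥ b = M *ᵥ B₀.col j ∧
      s * ‖toLp 2 b‖ ≤ ‖toLp 2 (M *ᵥ B₀.col j)‖ := by
    intro j
    set N := LinearMap.ker (Matrix.toLpLin 2 2 M) with hN
    let y : EuclideanSpace ℝ β := Nᗮ.starProjection (toLp 2 (B₀.col j))
    have hy : y ∈ Nᗮ := Submodule.starProjection_apply_mem _ _
    have hker : toLp 2 (B₀.col j) - y ∈ N := by
      have := Submodule.sub_starProjection_mem_orthogonal (K := Nᗮ) (toLp 2 (B₀.col j))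
      rwa [Submodule.orthogonal_orthogonal] at this
    have hMy : Matrix.toLpLin 2 2 M y = Matrix.toLpLin 2 2 M (toLp 2 (B₀.col j)) := by
      have := LinearMap.mem_ker.1 hker
      rw [map_sub, sub_eq_zero] at this
      exact this.symm
    refine ⟨y.ofLp, congrArg WithLp.ofLp hMy, ?_⟩
    exact (hs y hy).trans_eq (congrArg norm hMy)
  choose b hb hb' using hcol
  have hM : M * (Matrix.of b)ᵀ = M * B₀ := by
    ext i j
    have := congrFun (hb j) i
    simpa [Matrix.mul_apply, Matrix.mulVec, dotProduct] using this
  refine ⟨(Matrix.of b)ᵀ, hM, ?_⟩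
  refine abs_le_of_sq_le_sq' ?_ (frobNorm_nonneg _) |>.2
  rw [mul_pow, frobNorm_sq_eq_sum_col, frobNorm_sq_eq_sum_col, Finset.mul_sum]
  refine Finset.sum_le_sum fun j _ => ?_
  have h1 : (M * B₀).col j = M *ᵥ B₀.col j := by
    ext i; simp [Matrix.mul_apply, Matrix.mulVec, dotProduct]
  rw [h1, ← mul_pow]
  have := hb' j
  gcongr
  exact this

/-- A symmetric matrix of the same rank as its leading block `Q` has the form
`(Q, QB; BᵀQ, BᵀQB)`. -/
lemma exists_toBlocks_eq_of_isSymm {P : Matrix (α ⊕ β) (α ⊕ β) ℝ} (hP : P.rank ≤ P.toBlocks₁₁.rank)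
    (hsymm : P.IsSymm) {s : ℝ} (hs0 : 0 ≤ s)
    (hs : ∀ x ∈ (LinearMap.ker (Matrix.toLpLin 2 2 P.toBlocks₁₁))ᗮ,
      s * ‖x‖ ≤ ‖Matrix.toLpLin 2 2 P.toBlocks₁₁ x‖) :
    ∃ B : Matrix α β ℝ, P.toBlocks₁₂ = P.toBlocks₁₁ * B ∧
      P.toBlocks₂₂ = Bᵀ * P.toBlocks₁₁ * B ∧ s * frobNorm B ≤ frobNorm P.toBlocks₁₂ := by
  obtain ⟨B₀, h12, h22⟩ := exists_toBlocks_eq_mul hP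
  obtain ⟨B, hB, hBs⟩ := exists_mul_eq_and_frobNorm_le hs0 hs B₀
  have h11 : P.toBlocks₁₁ᵀ = P.toBlocks₁₁ := by
    ext i j; exact congrFun (congrFun hsymm (Sum.inl i)) (Sum.inl j)
  have h21 : P.toBlocks₂₁ = P.toBlocks₁₂ᵀ := by
    ext i j; exact (congrFun (congrFun hsymm (Sum.inr i)) (Sum.inl j)).symm
  refine ⟨B, by rw [hB, h12], ?_, by rwa [h12]⟩
  have h12' : P.toBlocks₁₂ᵀ = B₀ᵀ * P.toBlocks₁₁ := by rw [h12, transpose_mul, h11]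
  have h12'' : P.toBlocks₁₂ᵀ = Bᵀ * P.toBlocks₁₁ := by rw [h12, ← hB, transpose_mul, h11]
  rw [h22, h21, h12', Matrix.mul_assoc, ← hB, ← Matrix.mul_assoc, ← h12', h12'']

/-! ### Error of the estimate of the unobserved block -/

lemma frobNorm_mul_mul_le (A : Matrix α β ℝ) (X : Matrix β β ℝ) (B : Matrix β γ ℝ) :
    frobNorm (A * X * B) ≤ ‖A‖ * frobNorm X * ‖B‖ :=
  (frobNorm_mul_le' _ _).trans (by gcongr; exact frobNorm_mul_le _ _)

/-- Replacing `Q⁺` by the Moore–Penrose inverse of a perturbation `T = Q + E` in `Q Q⁺ Q = Q`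
costs only a multiple of `‖E‖_F`. -/
lemma frobNorm_mul_moorePenrose_mul_sub_le {Q T X : Matrix α α ℝ} (hX : IsMoorePenrose T X) :
    frobNorm (Q * X * Q - Q) ≤ (3 + ‖T - Q‖ * ‖X‖) * frobNorm (T - Q) := by
  set E := T - Q with hE
  have hQ : Q = T - E := by rw [hE]; abel
  have e : Q * X * Q - Q = E - T * X * E - E * (X * T) + E * X * E := by
    rw [hQ]
    simp only [Matrix.sub_mul, Matrix.mul_sub, hX.mul_mul_self, ← Matrix.mul_assoc]
    abel
  rw [e]
  have h1 : frobNorm (T * X * E) ≤ 1 * frobNorm E :=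
    (frobNorm_mul_le _ _).trans
      (mul_le_mul_of_nonneg_right hX.opNorm_mul_le_one (frobNorm_nonneg _))
  have h2 : frobNorm (E * (X * T)) ≤ frobNorm E * 1 :=
    (frobNorm_mul_le' _ _).trans
      (mul_le_mul_of_nonneg_left hX.opNorm_mul_le_one' (frobNorm_nonneg _))
  have h3 : frobNorm (E * X * E) ≤ ‖E‖ * ‖X‖ * frobNorm E :=
    (frobNorm_mul_le _ _).trans
      (mul_le_mul_of_nonneg_right (Matrix.l2_opNorm_mul _ _) (frobNorm_nonneg _))
  have h4 := frobNorm_add_le (E - T * X * E - E * (X * T)) (E * X * E)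
  have h5 := frobNorm_sub_le (E - T * X * E) (E * (X * T))
  have h6 := frobNorm_sub_le E (T * X * E)
  linarith

/-- Error of the estimate of the unobserved block, where `s` is a lower bound for the nonzero
singular values of the leading block of `P`. -/
lemma frobNorm_leOutput_sub_le {n m : ℕ} {A P : Matrix (Fin n ⊕ Fin m) (Fin n ⊕ Fin m) ℝ}
    {R : Matrix (Fin m) (Fin m) ℝ} {s δ₁ δ₂ : ℝ} (hs0 : 0 < s) (hP : P.rank = P.toBlocks₁₁.rank)
    (hsymm : P.IsSymm)
    (hs : ∀ x ∈ (LinearMap.ker (Matrix.toLpLin 2 2 P.toBlocks₁₁))ᗮ,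
      s * ‖x‖ ≤ ‖Matrix.toLpLin 2 2 P.toBlocks₁₁ x‖)
    (h₁ : ‖A.toBlocks₁₁ - P.toBlocks₁₁‖ ≤ δ₁) (h₂ : ‖A.toBlocks₁₂ - P.toBlocks₁₂‖ ≤ δ₂)
    (hδ₁ : δ₁ ≤ s / 2) (hR : IsLEOutput P.rank A.toBlocks₁₁ A.toBlocks₁₂ R) :
    frobNorm (R - P.toBlocks₂₂) ≤ Real.sqrt P.rank *
      (20 * (frobNorm P.toBlocks₁₂ / s) ^ 2 * δ₁ + 4 / s * δ₂ * frobNorm P.toBlocks₁₂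
        + 2 / s * δ₂ ^ 2) := by
  obtain ⟨T, X, hT, hX, rfl⟩ := hR
  obtain ⟨B, h12, h22, hB⟩ := exists_toBlocks_eq_of_isSymm hP.le hsymm hs0.le hs
  have h11 : P.toBlocks₁₁ᵀ = P.toBlocks₁₁ := by
    ext i j; exact congrFun (congrFun hsymm (Sum.inl i)) (Sum.inl j)
  set Q := P.toBlocks₁₁ with hQ
  set K := P.rank with hK
  set P₁₂ := P.toBlocks₁₂ with hP12
  set W := A.toBlocks₁₂ - P₁₂ with hW
  have hXn : ‖X‖ ≤ 2 / s := opNorm_moorePenrose_le hs0 hs (hP ▸ hT) hX (h₁.trans hδ₁)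
  have hE : ‖T - Q‖ ≤ 2 * δ₁ := (hT.opNorm_sub_le_two_mul hP.ge).trans (by gcongr)
  have hEF : frobNorm (T - Q) ≤ 4 * Real.sqrt K * δ₁ :=
    (hT.frobNorm_sub_le hP.ge).trans (by gcongr)
  have hXF : frobNorm X ≤ Real.sqrt K * (2 / s) :=
    (frobNorm_le_sqrt_rank_mul X (hX.rank_le.trans hT.rank_le)).trans (by gcongr)
  have hδ₁0 : 0 ≤ δ₁ := (norm_nonneg _).trans h₁
  have hδ₂0 : 0 ≤ δ₂ := (norm_nonneg _).trans h₂
  have hBb : ‖B‖ ≤ frobNorm P₁₂ / s :=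
    (opNorm_le_frobNorm B).trans (by rw [le_div_iff₀ hs0, mul_comm]; exact hB)
  have hEX : ‖T - Q‖ * ‖X‖ ≤ 2 := by
    calc ‖T - Q‖ * ‖X‖ ≤ (2 * δ₁) * (2 / s) := by gcongr
      _ ≤ (2 * (s / 2)) * (2 / s) := by gcongr
      _ = 2 := by field_simp
  have hD : frobNorm (Q * X * Q - Q) ≤ 20 * Real.sqrt K * δ₁ := by
    refine (frobNorm_mul_moorePenrose_mul_sub_le hX).trans ?_
    calc _ ≤ (3 + 2) * (4 * Real.sqrt K * δ₁) := by gcongr; exact frobNorm_nonneg _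
      _ = _ := by ring
  have hdecomp : A.toBlocks₁₂ᵀ * X * A.toBlocks₁₂ - P.toBlocks₂₂ =
      Bᵀ * (Q * X * Q - Q) * B + Wᵀ * X * P₁₂ + P₁₂ᵀ * X * W + Wᵀ * X * W := by
    have hA : A.toBlocks₁₂ = P₁₂ + W := by rw [hW]; abel
    have hPP : P₁₂ᵀ * X * P₁₂ = Bᵀ * (Q * X * Q) * B := by
      rw [h12, transpose_mul, h11]; simp only [Matrix.mul_assoc]
    rw [hA, h22, Matrix.mul_sub, Matrix.sub_mul, ← hPP, Matrix.transpose_add]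
    simp only [Matrix.add_mul, Matrix.mul_add]
    abel
  have hPn : ‖P₁₂‖ ≤ frobNorm P₁₂ := opNorm_le_frobNorm _
  have t1 : frobNorm (Bᵀ * (Q * X * Q - Q) * B) ≤
      (frobNorm P₁₂ / s) * (20 * Real.sqrt K * δ₁) * (frobNorm P₁₂ / s) := by
    refine (frobNorm_mul_mul_le _ _ _).trans ?_
    rw [opNorm_transpose]
    have := frobNorm_nonneg (Q * X * Q - Q)
    have := div_nonneg (frobNorm_nonneg P₁₂) hs0.le
    gcongr
  have t2 : frobNorm (Wᵀ * X * P₁₂) ≤ δ₂ * (Real.sqrt K * (2 / s)) * frobNorm P₁₂ := by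
    refine (frobNorm_mul_mul_le _ _ _).trans ?_
    rw [opNorm_transpose]
    have := frobNorm_nonneg X
    gcongr
  have t3 : frobNorm (P₁₂ᵀ * X * W) ≤ frobNorm P₁₂ * (Real.sqrt K * (2 / s)) * δ₂ := by
    refine (frobNorm_mul_mul_le _ _ _).trans ?_
    rw [opNorm_transpose]
    have := frobNorm_nonneg X
    have := frobNorm_nonneg P₁₂
    gcongr
  have t4 : frobNorm (Wᵀ * X * W) ≤ δ₂ * (Real.sqrt K * (2 / s)) * δ₂ := by
    refine (frobNorm_mul_mul_le _ _ _).trans ?_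
    rw [opNorm_transpose]
    have := frobNorm_nonneg X
    gcongr
  rw [hdecomp]
  have a1 := frobNorm_add_le (Bᵀ * (Q * X * Q - Q) * B + Wᵀ * X * P₁₂ + P₁₂ᵀ * X * W) (Wᵀ * X * W)
  have a2 := frobNorm_add_le (Bᵀ * (Q * X * Q - Q) * B + Wᵀ * X * P₁₂) (P₁₂ᵀ * X * W)
  have a3 := frobNorm_add_le (Bᵀ * (Q * X * Q - Q) * B) (Wᵀ * X * P₁₂)
  calc _ ≤ (frobNorm P₁₂ / s) * (20 * Real.sqrt K * δ₁) * (frobNorm P₁₂ / s)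
        + δ₂ * (Real.sqrt K * (2 / s)) * frobNorm P₁₂
        + frobNorm P₁₂ * (Real.sqrt K * (2 / s)) * δ₂ + δ₂ * (Real.sqrt K * (2 / s)) * δ₂ := by
        linarith
    _ = _ := by ring

/-! ### Error of the full estimate -/

omit [DecidableEq α] [DecidableEq β] in
lemma frobNorm_clip_sub_le {M M' : Matrix α β ℝ} (h : ∀ i j, M' i j ∈ Set.Icc (0 : ℝ) 1) :
    frobNorm (clip M - M') ≤ frobNorm (M - M') := by
  refine frobNorm_mono fun i j => ?_
  obtain ⟨h0, h1⟩ := h i j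
  simp only [clip, Matrix.sub_apply, Matrix.map_apply]
  calc |max 0 (min 1 (M i j)) - M' i j| = |max 0 (min 1 (M i j)) - max 0 (min 1 (M' i j))| := by
        rw [min_eq_right h1, max_eq_right h0]
    _ ≤ |min 1 (M i j) - min 1 (M' i j)| := by
        rw [max_comm 0, max_comm 0]; exact abs_max_sub_max_le_abs _ _ _
    _ ≤ |M i j - M' i j| := by
        rw [min_comm 1, min_comm 1]
        simpa using abs_min_sub_min_le_max (M i j) 1 (M' i j) 1

omit [DecidableEq α] in
lemma frobNorm_symmetrize_sub_le {M M' : Matrix α α ℝ} (h : M'.IsSymm) :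
    frobNorm ((1 / 2 : ℝ) • (M + Mᵀ) - M') ≤ frobNorm (M - M') := by
  have e : (1 / 2 : ℝ) • (M + Mᵀ) - M' = (1 / 2 : ℝ) • ((M - M') + (M - M')ᵀ) := by
    rw [Matrix.transpose_sub, h.eq]
    ext i j
    simp
    ring
  rw [e, frobNorm_smul]
  have := frobNorm_add_le (M - M') (M - M')ᵀ
  rw [frobNorm_transpose] at this
  rw [abs_of_pos (by norm_num)]
  linarith

omit [DecidableEq α] [DecidableEq β] [DecidableEq γ] in
lemma frobNorm_fromBlocks_le {δ : Type*} [Fintype δ] (a : Matrix α γ ℝ) (b : Matrix α δ ℝ)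
    (c : Matrix β γ ℝ) (d : Matrix β δ ℝ) :
    frobNorm (Matrix.fromBlocks a b c d) ≤ frobNorm a + frobNorm b + frobNorm c + frobNorm d := by
  have ha := frobNorm_nonneg a
  have hb := frobNorm_nonneg b
  have hc := frobNorm_nonneg c
  have hd := frobNorm_nonneg d
  refine abs_le_of_sq_le_sq' ?_ (by positivity) |>.2
  have : frobNorm (Matrix.fromBlocks a b c d) ^ 2 =
      frobNorm a ^ 2 + frobNorm b ^ 2 + frobNorm c ^ 2 + frobNorm d ^ 2 := by
    simp only [frobNorm_sq, Fintype.sum_sum_type, Matrix.fromBlocks_apply₁₁,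
      Matrix.fromBlocks_apply₁₂, Matrix.fromBlocks_apply₂₁, Matrix.fromBlocks_apply₂₂,
      Finset.sum_add_distrib]
    ring
  rw [this]
  have h1 := mul_nonneg ha hb
  have h2 := mul_nonneg ha hc
  have h3 := mul_nonneg ha hd
  have h4 := mul_nonneg hb hc
  have h5 := mul_nonneg hb hd
  have h6 := mul_nonneg hc hd
  nlinarith

omit [DecidableEq α] [DecidableEq β] [DecidableEq γ] in
lemma frobNorm_toCols₁_le (M : Matrix α (β ⊕ γ) ℝ) : frobNorm M.toCols₁ ≤ frobNorm M := by
  refine Real.sqrt_le_sqrt (Finset.sum_le_sum fun i _ => ?_)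
  rw [Fintype.sum_sum_type]
  exact le_add_of_nonneg_right (Finset.sum_nonneg fun j _ => sq_nonneg _)

omit [DecidableEq α] [DecidableEq β] [DecidableEq γ] in
lemma frobNorm_toCols₂_le (M : Matrix α (β ⊕ γ) ℝ) : frobNorm M.toCols₂ ≤ frobNorm M := by
  refine Real.sqrt_le_sqrt (Finset.sum_le_sum fun i _ => ?_)
  rw [Fintype.sum_sum_type]
  exact le_add_of_nonneg_left (Finset.sum_nonneg fun j _ => sq_nonneg _)

omit [DecidableEq α] in
lemma opNorm_fromCols_le (M : Matrix α β ℝ) (M' : Matrix α γ ℝ) :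
    ‖Matrix.fromCols M M'‖ ≤ ‖M‖ + ‖M'‖ := by
  refine opNorm_le_of_mulVec _ (by positivity) fun x => ?_
  have h1 : ‖toLp 2 (x ∘ Sum.inl)‖ ≤ ‖toLp 2 x‖ := by
    refine abs_le_of_sq_le_sq' ?_ (norm_nonneg _) |>.2
    rw [norm_toLp_sq, norm_toLp_sq, Fintype.sum_sum_type]
    exact le_add_of_nonneg_right (Finset.sum_nonneg fun j _ => sq_nonneg _)
  have h2 : ‖toLp 2 (x ∘ Sum.inr)‖ ≤ ‖toLp 2 x‖ := by
    refine abs_le_of_sq_le_sq' ?_ (norm_nonneg _) |>.2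
    rw [norm_toLp_sq, norm_toLp_sq, Fintype.sum_sum_type]
    exact le_add_of_nonneg_left (Finset.sum_nonneg fun j _ => sq_nonneg _)
  rw [Matrix.fromCols_mulVec, WithLp.toLp_add, add_mul]
  refine (norm_add_le _ _).trans (add_le_add ?_ ?_)
  · exact (norm_toLp_mulVec_le _ _).trans (by gcongr)
  · exact (norm_toLp_mulVec_le _ _).trans (by gcongr)

/-- The deterministic error bound: only the operator norms of the two noise blocks enter. -/
lemma IsFullEstimate.frobNorm_sub_le {n m : ℕ}
    {A P Phat : Matrix (Fin n ⊕ Fin m) (Fin n ⊕ Fin m) ℝ} {s δ₁ δ₂ : ℝ} (hs0 : 0 < s)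
    (hP : P.rank = P.toBlocks₁₁.rank) (hsymm : P.IsSymm) (hP01 : ∀ i j, P i j ∈ Set.Icc (0 : ℝ) 1)
    (hs : ∀ x ∈ (LinearMap.ker (Matrix.toLpLin 2 2 P.toBlocks₁₁))ᗮ,
      s * ‖x‖ ≤ ‖Matrix.toLpLin 2 2 P.toBlocks₁₁ x‖)
    (h₁ : ‖A.toBlocks₁₁ - P.toBlocks₁₁‖ ≤ δ₁) (h₂ : ‖A.toBlocks₁₂ - P.toBlocks₁₂‖ ≤ δ₂)
    (hδ₁ : δ₁ ≤ s / 2) {b₁ b₂ b₃ : Bool} (hPhat : IsFullEstimate b₁ b₂ b₃ P.rank A Phat) :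
    frobNorm (Phat - P) ≤ Real.sqrt P.rank *
      (12 * (δ₁ + δ₂) + 20 * (frobNorm P.toBlocks₁₂ / s) ^ 2 * δ₁
        + 4 / s * δ₂ * frobNorm P.toBlocks₁₂ + 2 / s * δ₂ ^ 2) := by
  obtain ⟨T, R, hT, hR, hPh⟩ := hPhat
  have h11 : P.toBlocks₁₁.IsSymm := by
    ext i j; exact congrFun (congrFun hsymm (Sum.inl i)) (Sum.inl j)
  have h21 : P.toBlocks₂₁ = P.toBlocks₁₂ᵀ := by
    ext i j; exact (congrFun (congrFun hsymm (Sum.inr i)) (Sum.inl j)).symm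
  have hTF : frobNorm (T - Matrix.fromCols P.toBlocks₁₁ P.toBlocks₁₂) ≤
      4 * Real.sqrt P.rank * (δ₁ + δ₂) := by
    refine (hT.frobNorm_sub_le ?_).trans ?_
    · have : Matrix.fromCols P.toBlocks₁₁ P.toBlocks₁₂ = P.submatrix Sum.inl id := by
        ext i (j | j) <;> rfl
      rw [this]
      exact Matrix.rank_submatrix_le _ _ _
    · have : Matrix.fromCols A.toBlocks₁₁ A.toBlocks₁₂ - Matrix.fromCols P.toBlocks₁₁ P.toBlocks₁₂ =
          Matrix.fromCols (A.toBlocks₁₁ - P.toBlocks₁₁) (A.toBlocks₁₂ - P.toBlocks₁₂) := by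
        ext i (j | j) <;> rfl
      rw [this]
      gcongr
      exact (opNorm_fromCols_le _ _).trans (add_le_add h₁ h₂)
  have hT1 : frobNorm (T.toCols₁ - P.toBlocks₁₁) ≤ 4 * Real.sqrt P.rank * (δ₁ + δ₂) :=
    (frobNorm_toCols₁_le (T - Matrix.fromCols P.toBlocks₁₁ P.toBlocks₁₂)).trans hTF
  have hT2 : frobNorm (T.toCols₂ - P.toBlocks₁₂) ≤ 4 * Real.sqrt P.rank * (δ₁ + δ₂) :=
    (frobNorm_toCols₂_le (T - Matrix.fromCols P.toBlocks₁₁ P.toBlocks₁₂)).trans hTF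
  have hRF := frobNorm_leOutput_sub_le hs0 hP hsymm hs h₁ h₂ hδ₁ hR
  dsimp only at hPh
  set B11 := if b₁ then (1 / 2 : ℝ) • (T.toCols₁ + T.toCols₁ᵀ) else T.toCols₁ with hB11
  set Q11 := if b₂ then clip B11 else B11 with hQ11
  set Q12 := if b₂ then clip T.toCols₂ else T.toCols₂ with hQ12
  set Q22 := if b₃ then clip R else R with hQ22
  have c0 : frobNorm (B11 - P.toBlocks₁₁) ≤ frobNorm (T.toCols₁ - P.toBlocks₁₁) := by
    rw [hB11]; split_ifs
    · exact frobNorm_symmetrize_sub_le h11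
    · exact le_rfl
  have c1 : frobNorm (Q11 - P.toBlocks₁₁) ≤ frobNorm (B11 - P.toBlocks₁₁) := by
    rw [hQ11]; split_ifs
    · exact frobNorm_clip_sub_le fun i j => hP01 _ _
    · exact le_rfl
  have c2 : frobNorm (Q12 - P.toBlocks₁₂) ≤ frobNorm (T.toCols₂ - P.toBlocks₁₂) := by
    rw [hQ12]; split_ifs
    · exact frobNorm_clip_sub_le fun i j => hP01 _ _
    · exact le_rfl
  have c3 : frobNorm (Q22 - P.toBlocks₂₂) ≤ frobNorm (R - P.toBlocks₂₂) := by
    rw [hQ22]; split_ifs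
    · exact frobNorm_clip_sub_le fun i j => hP01 _ _
    · exact le_rfl
  have hsub : Phat - P = Matrix.fromBlocks (Q11 - P.toBlocks₁₁) (Q12 - P.toBlocks₁₂)
      (Q12 - P.toBlocks₁₂)ᵀ (Q22 - P.toBlocks₂₂) := by
    nth_rw 1 [← Matrix.fromBlocks_toBlocks P, h21, hPh, Matrix.transpose_sub]
    ext (i | i) (j | j) <;> rfl
  have hbl := frobNorm_fromBlocks_le (Q11 - P.toBlocks₁₁) (Q12 - P.toBlocks₁₂)
    (Q12 - P.toBlocks₁₂)ᵀ (Q22 - P.toBlocks₂₂)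
  rw [frobNorm_transpose] at hbl
  rw [hsub]
  calc _ ≤ 3 * (4 * Real.sqrt P.rank * (δ₁ + δ₂)) + frobNorm (R - P.toBlocks₂₂) := by linarith
    _ ≤ _ := add_le_add_right hRF _
    _ = _ := by ring

end

/-! ### Maps with the same kernel -/

/-- Two maps on the same index type have the same kernel if they identify the same indices. -/
def SameKernel {τ α α' : Type*} (f : τ → α) (f' : τ → α') : Prop :=
  ∀ s t, f s = f t ↔ f' s = f' t

lemma SameKernel.exists_comp {τ α α' : Type*} [Nonempty τ] {f : τ → α} {f' : τ → α'}
    (h : SameKernel f f') : ∃ φ : α → α', f' = φ ∘ f ∧ Set.InjOn φ (Set.range f) := by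
  have : Nonempty α' := ⟨f' (Classical.arbitrary τ)⟩
  have hfac : f'.FactorsThrough f := fun s t hst => (h s t).1 hst
  have hφ : ∀ t, Function.extend f f' (fun _ => Classical.arbitrary α') (f t) = f' t :=
    fun t => hfac.extend_apply _ t
  refine ⟨Function.extend f f' fun _ => Classical.arbitrary α', funext fun t => (hφ t).symm, ?_⟩
  rintro _ ⟨s, rfl⟩ _ ⟨t, rfl⟩ hst
  rw [hφ, hφ] at hst
  exact (h s t).2 hst

lemma SameKernel.card_image_eq {τ α α' : Type*} [Fintype τ] [Nonempty τ] [DecidableEq α]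
    [DecidableEq α'] {f : τ → α} {f' : τ → α'} (h : SameKernel f f') :
    (Finset.univ.image f').card = (Finset.univ.image f).card := by
  obtain ⟨φ, rfl, hφ⟩ := h.exists_comp
  rw [← Finset.image_image, Finset.card_image_of_injOn]
  simpa using hφ

/-- The maps with the same kernel as `f` are the injections of the range of `f`. -/
lemma card_sameKernel {τ α α' : Type*} [Fintype τ] [Fintype α'] [DecidableEq τ]
    [Nonempty τ] [DecidableEq α] [DecidableEq α'] (f : τ → α)
    [DecidablePred fun f' : τ → α' => SameKernel f f'] :
    (Finset.univ.filter fun f' : τ → α' => SameKernel f f').card =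
      (Fintype.card α').descFactorial (Finset.univ.image f).card := by
  have hmem : ∀ t, f t ∈ Finset.univ.image f :=
    fun t => Finset.mem_image_of_mem f (Finset.mem_univ t)
  rw [← Fintype.card_coe (Finset.univ.image f), ← Fintype.card_embedding_eq, ← Finset.card_univ]
  symm
  refine Finset.card_bij (fun φ _ t => φ ⟨f t, hmem t⟩) ?_ ?_ ?_
  · intro φ _
    simp only [Finset.mem_filter, Finset.mem_univ, true_and]
    intro s t
    simp
  · intro φ _ ψ _ h
    ext ⟨y, hy⟩
    obtain ⟨t, -, rfl⟩ := Finset.mem_image.1 hy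
    exact congrFun h t
  · intro f' hf'
    simp only [Finset.mem_filter, Finset.mem_univ, true_and] at hf'
    obtain ⟨φ, rfl, hφ⟩ := hf'.exists_comp
    refine ⟨⟨fun y => φ y, ?_⟩, Finset.mem_univ _, rfl⟩
    rintro ⟨y, hy⟩ ⟨z, hz⟩ hyz
    simp only [Finset.mem_image, Finset.mem_univ, true_and] at hy hz
    exact Subtype.ext (hφ hy hz hyz)

/-- Comparison of sums over maps into alphabets of different sizes: a factor `p` for every letter
used makes the alphabet `α` cheaper than one with at least `p |α| + |τ|` letters. -/
lemma sum_pow_card_image_mul_le {τ α α' : Type*} [Fintype τ] [Nonempty τ] [DecidableEq τ]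
    [Fintype α] [DecidableEq α] [Fintype α'] [DecidableEq α'] {p : ℝ} (hp : 0 ≤ p)
    (hcard : p * Fintype.card α + Fintype.card τ ≤ Fintype.card α')
    {h : (τ → α) → ℝ} {h' : (τ → α') → ℝ} (h'0 : ∀ f', 0 ≤ h' f')
    (hh : ∀ f f', SameKernel f f' → h f ≤ h' f') :
    ∑ f, p ^ (Finset.univ.image f).card * h f ≤ ∑ f', h' f' := by
  classical
  have hτ : Fintype.card τ ≤ Fintype.card α' := by
    have : (0 : ℝ) ≤ p * Fintype.card α := by positivity
    exact_mod_cast (by linarith : (Fintype.card τ : ℝ) ≤ Fintype.card α')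
  have hpos : ∀ {v : ℕ}, v ≤ Fintype.card τ → (0 : ℝ) < (Fintype.card α').descFactorial v :=
    fun hv => by exact_mod_cast Nat.descFactorial_pos.2 (hv.trans hτ)
  calc ∑ f, p ^ (Finset.univ.image f).card * h f
      ≤ ∑ f : τ → α, ∑ f' : τ → α', if SameKernel f f' then
          p ^ (Finset.univ.image f').card /
            (Fintype.card α').descFactorial (Finset.univ.image f').card * h' f' else 0 := by
        refine Finset.sum_le_sum fun f _ => ?_
        rw [← Finset.sum_filter]
        calc p ^ (Finset.univ.image f).card * h f
            = ∑ f' ∈ Finset.univ.filter (fun f' : τ → α' => SameKernel f f'),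
                p ^ (Finset.univ.image f).card /
                  (Fintype.card α').descFactorial (Finset.univ.image f).card * h f := by
              rw [Finset.sum_const, card_sameKernel, nsmul_eq_mul]
              have := (hpos (Finset.card_image_le (s := Finset.univ) (f := f))).ne'
              field_simp
          _ ≤ _ := by
              refine Finset.sum_le_sum fun f' hf' => ?_
              have hk := (Finset.mem_filter.1 hf').2
              rw [hk.card_image_eq]
              have := hh f f' hk
              gcongr
    _ = ∑ f' : τ → α', ∑ f : τ → α, if SameKernel f f' then
          p ^ (Finset.univ.image f').card /
            (Fintype.card α').descFactorial (Finset.univ.image f').card * h' f' else 0 :=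
        Finset.sum_comm
    _ ≤ ∑ f', h' f' := by
        refine Finset.sum_le_sum fun f' _ => ?_
        rw [← Finset.sum_filter, Finset.sum_const, nsmul_eq_mul]
        have hsymm : (Finset.univ.filter fun f : τ → α => SameKernel f f') =
            Finset.univ.filter fun f : τ → α => SameKernel f' f := by
          exact Finset.filter_congr fun f _ => forall₂_congr fun _ _ => iff_comm
        rw [hsymm, card_sameKernel]
        set v := (Finset.univ.image f').card with hvdef
        have hvτ : v ≤ Fintype.card τ := Finset.card_image_le
        have hα' : (p * Fintype.card α) ^ v ≤ ((Fintype.card α').descFactorial v : ℝ) := by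
          calc (p * Fintype.card α) ^ v
              ≤ ((Fintype.card α' + 1 - v : ℕ) : ℝ) ^ v := by
                have h1 : (v : ℝ) ≤ Fintype.card τ := by exact_mod_cast hvτ
                have h2 : v ≤ Fintype.card α' + 1 := by omega
                gcongr
                rw [Nat.cast_sub h2]
                push_cast
                linarith
            _ ≤ _ := by exact_mod_cast Nat.pow_sub_le_descFactorial _ _
        have hα : ((Fintype.card α).descFactorial v : ℝ) ≤ (Fintype.card α : ℝ) ^ v := by
          exact_mod_cast Nat.descFactorial_le_pow _ _
        have hD := hpos hvτ
        calc ((Fintype.card α).descFactorial v : ℝ) *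
              (p ^ v / (Fintype.card α').descFactorial v * h' f')
            ≤ (Fintype.card α : ℝ) ^ v * (p ^ v / (Fintype.card α').descFactorial v * h' f') := by
              have := h'0 f'
              gcongr
          _ = (p * Fintype.card α) ^ v / (Fintype.card α').descFactorial v * h' f' := by
              rw [mul_pow]; ring
          _ ≤ 1 * h' f' := by
              refine mul_le_mul_of_nonneg_right ?_ (h'0 f')
              rwa [div_le_one hD]
          _ = h' f' := one_mul _

/-! ### Products of moments along a map -/

/-- The product of `c (multiplicity of e)` over the values `e` of `E`. -/
def momentProd {τ ι : Type*} [Fintype τ] [DecidableEq ι] (c : ℕ → ℝ) (E : τ → ι) : ℝ :=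
  ∏ e ∈ Finset.univ.image E, c (Finset.univ.filter fun t => E t = e).card

lemma momentProd_nonneg {τ ι : Type*} [Fintype τ] [DecidableEq ι] {c : ℕ → ℝ} (hc : ∀ m, 0 ≤ c m)
    (E : τ → ι) : 0 ≤ momentProd c E := Finset.prod_nonneg fun _ _ => hc _

lemma SameKernel.momentProd_eq {τ ι ι' : Type*} [Fintype τ] [Nonempty τ] [DecidableEq ι]
    [DecidableEq ι'] (c : ℕ → ℝ) {E : τ → ι} {E' : τ → ι'} (h : SameKernel E E') :
    momentProd c E = momentProd c E' := by
  obtain ⟨φ, rfl, hφ⟩ := h.exists_comp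
  rw [momentProd, momentProd, ← Finset.image_image,
    Finset.prod_image (s := Finset.univ.image E) (g := φ) (by simpa using hφ)]
  refine Finset.prod_congr rfl fun e he => ?_
  obtain ⟨s, -, rfl⟩ := Finset.mem_image.1 he
  congr 2
  ext t
  simpa using h t s

lemma momentProd_eq_prod_univ {τ ι : Type*} [Fintype τ] [Fintype ι] [DecidableEq ι] {c : ℕ → ℝ}
    (hc : c 0 = 1) (E : τ → ι) :
    momentProd c E = ∏ e, c (Finset.univ.filter fun t => E t = e).card := by
  refine Finset.prod_subset (Finset.subset_univ _) fun e _ he => ?_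
  rw [Finset.filter_eq_empty_iff.2, Finset.card_empty, hc]
  intro t _ ht
  exact he (Finset.mem_image.2 ⟨t, Finset.mem_univ _, ht⟩)

lemma prod_comp_eq_prod_pow {τ ι : Type*} [Fintype τ] [Fintype ι] [DecidableEq ι] (x : ι → ℝ)
    (E : τ → ι) : ∏ t, x (E t) = ∏ e, x e ^ (Finset.univ.filter fun t => E t = e).card := by
  rw [Finset.prod_comp]
  refine Finset.prod_subset (Finset.subset_univ _) fun e _ he => ?_
  rw [Finset.filter_eq_empty_iff.2, Finset.card_empty, pow_zero]
  intro t _ ht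
  exact he (Finset.mem_image.2 ⟨t, Finset.mem_univ _, ht⟩)

/-! ### Closed walks and traces of powers -/

/-- The `2k` edges of the bipartite walk `f 0, g 0, f 1, g 1, …, g (k - 1), f k`. -/
def walkEdge {α β : Type*} {k : ℕ} (f : Fin (k + 1) → α) (g : Fin k → β) : Fin k ⊕ Fin k → α × β :=
  Sum.elim (fun t => (f t.castSucc, g t)) (fun t => (f t.succ, g t))

lemma SameKernel.walkEdge {α β α' β' : Type*} {k : ℕ} {f : Fin (k + 1) → α} {g : Fin k → β}
    {f' : Fin (k + 1) → α'} {g' : Fin k → β'} (hf : SameKernel f f') (hg : SameKernel g g') :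
    SameKernel (walkEdge f g) (walkEdge f' g') := by
  rintro (s | s) (t | t) <;>
  simp [Egocentric.walkEdge, Prod.ext_iff, hf _ _, hg _ _]

lemma pow_apply_eq_sum {α : Type*} [Fintype α] [DecidableEq α] (B : Matrix α α ℝ) (k : ℕ)
    (a b : α) : (B ^ k) a b = ∑ f : Fin (k + 1) → α,
      if f 0 = a ∧ f (Fin.last k) = b then ∏ t : Fin k, B (f t.castSucc) (f t.succ) else 0 := by
  induction k generalizing a with
  | zero =>
    rw [pow_zero, Matrix.one_apply, Fintype.sum_equiv (Equiv.funUnique (Fin 1) α) _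
      (fun x => if x = a then (if x = b then 1 else 0) else 0)
      fun f => by simp [ite_and], Finset.sum_ite_eq' Finset.univ a]
    simp
  | succ k ih =>
    rw [pow_succ', Matrix.mul_apply, ← (Fin.consEquiv fun _ => α).sum_comp, Fintype.sum_prod_type]
    simp_rw [ih, Finset.mul_sum]
    rw [Finset.sum_comm, Finset.sum_comm (s := Finset.univ (α := α))]
    refine Finset.sum_congr rfl fun f _ => ?_
    simp only [Fin.consEquiv_apply, Fin.cons_zero, Fin.prod_univ_succ, Fin.castSucc_zero,
      Fin.cons_succ, ← Fin.succ_castSucc, ← Fin.succ_last, ite_and]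
    rw [Finset.sum_ite_eq' Finset.univ a, if_pos (Finset.mem_univ a)]
    simp only [mul_ite, mul_zero]
    rw [Finset.sum_ite_eq Finset.univ (f 0), if_pos (Finset.mem_univ _)]

lemma trace_mul_transpose_pow {α β : Type*} [Fintype α] [DecidableEq α] [Fintype β]
    (W : Matrix α β ℝ) (k : ℕ) :
    ((W * Wᵀ) ^ k).trace = ∑ f : Fin (k + 1) → α, ∑ g : Fin k → β,
      (if f 0 = f (Fin.last k) then 1 else 0) *
        ∏ t, W (walkEdge f g t).1 (walkEdge f g t).2 := by
  simp only [Matrix.trace, Matrix.diag_apply, pow_apply_eq_sum]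
  rw [Finset.sum_comm]
  refine Finset.sum_congr rfl fun f _ => ?_
  simp only [ite_and]
  rw [Finset.sum_ite_eq Finset.univ (f 0), if_pos (Finset.mem_univ _), ← Finset.mul_sum]
  simp only [ite_mul, one_mul, zero_mul, eq_comm (a := f (Fin.last k))]
  congr 1
  simp only [Matrix.mul_apply, Matrix.transpose_apply, Fintype.prod_sum_type, walkEdge,
    Sum.elim_inl, Sum.elim_inr, ← Finset.prod_mul_distrib]
  rw [Finset.prod_univ_sum, Fintype.piFinset_univ]

/-- A connected graph has at most one more vertex than it has edges, for the graph traced out by a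
bipartite walk. -/
lemma card_image_add_card_image_le {α β : Type*} [DecidableEq α] [DecidableEq β] (x : ℕ → α)
    (y : ℕ → β) (k : ℕ) :
    ((Finset.range (k + 1)).image x).card + ((Finset.range k).image y).card ≤
      ((Finset.range k).image (fun t => (x t, y t)) ∪
        (Finset.range k).image (fun t => (x (t + 1), y t))).card + 1 := by
  induction k with
  | zero => simp
  | succ k ih =>
    set X := (Finset.range (k + 1)).image x with hX
    set Y := (Finset.range k).image y with hY
    set Z := (Finset.range k).image (fun t => (x t, y t)) ∪
        (Finset.range k).image (fun t => (x (t + 1), y t)) with hZ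
    have e1 : (Finset.range (k + 1 + 1)).image x = insert (x (k + 1)) X := by
      rw [Finset.range_add_one (n := k + 1), Finset.image_insert]
    have e2 : (Finset.range (k + 1)).image y = insert (y k) Y := by
      rw [Finset.range_add_one, Finset.image_insert]
    have e3 : (Finset.range (k + 1)).image (fun t => (x t, y t)) ∪
        (Finset.range (k + 1)).image (fun t => (x (t + 1), y t)) =
        insert (x (k + 1), y k) (insert (x k, y k) Z) := by
      rw [Finset.range_add_one, Finset.image_insert, Finset.image_insert]
      ext e
      simp only [hZ, Finset.mem_union, Finset.mem_insert]
      tauto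
    have hZX : ∀ e ∈ Z, e.1 ∈ X ∧ e.2 ∈ Y := by
      intro e he
      rcases Finset.mem_union.1 he with he | he <;>
      · obtain ⟨t, ht, rfl⟩ := Finset.mem_image.1 he
        have ht' := Finset.mem_range.1 ht
        exact ⟨Finset.mem_image_of_mem x (Finset.mem_range.2 (by omega)),
          Finset.mem_image_of_mem y ht⟩
    have hxk : x k ∈ X := Finset.mem_image_of_mem x (Finset.mem_range.2 (by omega))
    rw [e1, e2, e3]
    have hy : (insert (y k) Y).card + Z.card ≤ Y.card + (insert (x k, y k) Z).card := by
      by_cases h : y k ∈ Y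
      · rw [Finset.insert_eq_of_mem h]
        have := Finset.card_le_card (Finset.subset_insert (x k, y k) Z)
        omega
      · rw [Finset.card_insert_of_notMem h,
          Finset.card_insert_of_notMem fun hz => h (hZX _ hz).2]
        omega
    have hx : (insert (x (k + 1)) X).card + (insert (x k, y k) Z).card ≤
        X.card + (insert (x (k + 1), y k) (insert (x k, y k) Z)).card := by
      by_cases h : x (k + 1) ∈ X
      · rw [Finset.insert_eq_of_mem h]
        have := Finset.card_le_card (Finset.subset_insert (x (k + 1), y k) (insert (x k, y k) Z))
        omega
      · rw [Finset.card_insert_of_notMem h, Finset.card_insert_of_notMem (a := (x (k + 1), y k))]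
        · omega
        · intro hz
          rcases Finset.mem_insert.1 hz with hz | hz
          · have h1 : x (k + 1) = x k := (Prod.ext_iff.1 hz).1
            exact h (h1 ▸ hxk)
          · exact h (hZX _ hz).1
    omega

lemma card_image_add_card_image_le_walkEdge {α β : Type*} [DecidableEq α] [DecidableEq β] {k : ℕ}
    (f : Fin (k + 1) → α) (g : Fin k → β) :
    (Finset.univ.image f).card + (Finset.univ.image g).card ≤
      (Finset.univ.image (walkEdge f g)).card + 1 := by
  rcases Nat.eq_zero_or_pos k with rfl | hk
  · simp
  set x : ℕ → α := fun t => if h : t < k + 1 then f ⟨t, h⟩ else f 0 with hx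
  set y : ℕ → β := fun t => if h : t < k then g ⟨t, h⟩ else g ⟨0, hk⟩ with hy
  have h := card_image_add_card_image_le x y k
  have hxf : ∀ t : Fin (k + 1), x t = f t := fun t => dif_pos t.2
  have hyg : ∀ t : Fin k, y t = g t := fun t => dif_pos t.2
  have e1 : Finset.univ.image f ⊆ (Finset.range (k + 1)).image x := by
    intro a ha
    obtain ⟨t, -, rfl⟩ := Finset.mem_image.1 ha
    exact Finset.mem_image.2 ⟨t, Finset.mem_range.2 t.2, hxf t⟩
  have e2 : Finset.univ.image g ⊆ (Finset.range k).image y := by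
    intro a ha
    obtain ⟨t, -, rfl⟩ := Finset.mem_image.1 ha
    exact Finset.mem_image.2 ⟨t, Finset.mem_range.2 t.2, hyg t⟩
  have e3 : (Finset.range k).image (fun t => (x t, y t)) ∪
      (Finset.range k).image (fun t => (x (t + 1), y t)) ⊆ Finset.univ.image (walkEdge f g) := by
    intro e he
    rcases Finset.mem_union.1 he with he | he <;> obtain ⟨t, ht, rfl⟩ := Finset.mem_image.1 he
    · have ht' := Finset.mem_range.1 ht
      refine Finset.mem_image.2 ⟨Sum.inl ⟨t, ht'⟩, Finset.mem_univ _, ?_⟩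
      exact Prod.ext (hxf (Fin.castSucc ⟨t, ht'⟩)).symm (hyg ⟨t, ht'⟩).symm
    · have ht' := Finset.mem_range.1 ht
      refine Finset.mem_image.2 ⟨Sum.inr ⟨t, ht'⟩, Finset.mem_univ _, ?_⟩
      exact Prod.ext (hxf (Fin.succ ⟨t, ht'⟩)).symm (hyg ⟨t, ht'⟩).symm
  have := Finset.card_le_card e1
  have := Finset.card_le_card e2
  have := Finset.card_le_card e3
  omega

/-! ### The reference ensemble -/

/-- The three equally likely values of an entry of the reference matrix: centred, and all moments
of order at least two are at least one. -/
def refValue : Fin 3 → ℝ := ![2, -1, -1]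

/-- The moments of the uniform distribution on the values `refValue`. -/
def refMoment (m : ℕ) : ℝ := (2 ^ m + 2 * (-1) ^ m) / 3

/-- The reference matrix with entries selected by `ω`. -/
def refMatrix {α β : Type*} (ω : α × β → Fin 3) : Matrix α β ℝ :=
  Matrix.of fun i j => refValue (ω (i, j))

lemma refMoment_zero : refMoment 0 = 1 := by norm_num [refMoment]

lemma refMoment_one : refMoment 1 = 0 := by norm_num [refMoment]

lemma one_le_refMoment {m : ℕ} (hm : 2 ≤ m) : 1 ≤ refMoment m := by
  obtain ⟨j, rfl⟩ := Nat.exists_eq_add_of_le hm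
  unfold refMoment
  rcases Nat.eq_zero_or_pos j with rfl | hj
  · norm_num
  have h2 : (2 : ℝ) ^ 1 ≤ 2 ^ j := pow_le_pow_right₀ (by norm_num) hj
  have h1 : -1 ≤ (-1 : ℝ) ^ (2 + j) := by
    rcases neg_one_pow_eq_or ℝ (2 + j) with h | h <;> simp [h]
  rw [pow_add]
  linarith

lemma refMoment_nonneg (m : ℕ) : 0 ≤ refMoment m := by
  rcases m with _ | _ | m
  · rw [refMoment_zero]; exact zero_le_one
  · rw [zero_add, refMoment_one]
  · exact zero_le_one.trans (one_le_refMoment (by omega))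

lemma sum_refValue_pow (m : ℕ) : ∑ a, refValue a ^ m = 3 * refMoment m := by
  simp [Fin.sum_univ_three, refValue, refMoment]
  ring

lemma sum_prod_refValue {τ ι : Type*} [Fintype τ] [Fintype ι] [DecidableEq ι] (E : τ → ι) :
    ∑ ω : ι → Fin 3, ∏ t, refValue (ω (E t)) = 3 ^ Fintype.card ι * momentProd refMoment E := by
  simp_rw [fun ω : ι → Fin 3 => prod_comp_eq_prod_pow (fun e => refValue (ω e)) E]
  rw [← Fintype.piFinset_univ,
    ← Finset.prod_univ_sum (fun _ => Finset.univ) (fun e a => refValue a ^ _)]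
  simp_rw [sum_refValue_pow]
  rw [Finset.prod_mul_distrib, Finset.prod_const, Finset.card_univ,
    momentProd_eq_prod_univ refMoment_zero]

lemma sum_trace_refMatrix {α β : Type*} [Fintype α] [DecidableEq α] [Fintype β] [DecidableEq β]
    (k : ℕ) :
    ∑ ω : α × β → Fin 3, ((refMatrix ω * (refMatrix ω)ᵀ) ^ k).trace =
      3 ^ Fintype.card (α × β) * ∑ f : Fin (k + 1) → α, ∑ g : Fin k → β,
        (if f 0 = f (Fin.last k) then 1 else 0) * momentProd refMoment (walkEdge f g) := by
  simp_rw [trace_mul_transpose_pow]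
  rw [Finset.sum_comm, Finset.mul_sum]
  refine Finset.sum_congr rfl fun f _ => ?_
  rw [Finset.sum_comm, Finset.mul_sum]
  refine Finset.sum_congr rfl fun g _ => ?_
  rw [← Finset.mul_sum, mul_left_comm, ← sum_prod_refValue]
  rfl

/-- Comparison of the trace moments of a sparse random matrix with those of the reference ensemble
of smaller size. The moment assumption is what independence of centred entries with values in
`[-1, 1]` and variance at most `p` yields. -/
lemma mul_integral_trace_le {Ω α β : Type*} [MeasurableSpace Ω] {μ : Measure Ω} [Fintype α]
    [DecidableEq α] [Fintype β] [DecidableEq β] {W : Ω → Matrix α β ℝ} {p : ℝ} (hp0 : 0 ≤ p)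
    (hp1 : p ≤ 1)
    (hint : ∀ m : α × β → ℕ, Integrable (fun ω => ∏ e, W ω e.1 e.2 ^ m e) μ)
    (hmom : ∀ m : α × β → ℕ, ∫ ω, ∏ e, W ω e.1 e.2 ^ m e ∂μ ≤
      ∏ e, if m e = 0 then 1 else p * refMoment (m e))
    {k r : ℕ} (hk : 0 < k) (hα : p * Fintype.card α + (k + 1) ≤ r)
    (hβ : p * Fintype.card β + k ≤ r) :
    p * ∫ ω, ((W ω * (W ω)ᵀ) ^ k).trace ∂μ ≤
      (∑ ω : Fin r × Fin r → Fin 3, ((refMatrix ω * (refMatrix ω)ᵀ) ^ k).trace) / 3 ^ (r * r) := by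
  have : Nonempty (Fin k) := ⟨⟨0, hk⟩⟩
  have hcr0 : ∀ f : Fin (k + 1) → Fin r, (0 : ℝ) ≤ if f 0 = f (Fin.last k) then 1 else 0 :=
    fun f => by split_ifs <;> norm_num
  have hca0 : ∀ f : Fin (k + 1) → α, (0 : ℝ) ≤ if f 0 = f (Fin.last k) then 1 else 0 :=
    fun f => by split_ifs <;> norm_num
  have hwalk : ∀ (f : Fin (k + 1) → α) (g : Fin k → β),
      Integrable (fun ω => ∏ t, W ω (walkEdge f g t).1 (walkEdge f g t).2) μ ∧
      p * ∫ ω, ∏ t, W ω (walkEdge f g t).1 (walkEdge f g t).2 ∂μ ≤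
        p ^ (Finset.univ.image f).card * p ^ (Finset.univ.image g).card *
          momentProd refMoment (walkEdge f g) := by
    intro f g
    simp_rw [fun ω => prod_comp_eq_prod_pow (fun e : α × β => W ω e.1 e.2) (walkEdge f g)]
    refine ⟨hint _, ?_⟩
    have h1 : (∏ e : α × β, if (Finset.univ.filter fun t => walkEdge f g t = e).card = 0 then 1 else
        p * refMoment (Finset.univ.filter fun t => walkEdge f g t = e).card) =
        p ^ (Finset.univ.image (walkEdge f g)).card * momentProd refMoment (walkEdge f g) := by
      rw [momentProd, ← Finset.prod_const, ← Finset.prod_mul_distrib]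
      symm
      refine Finset.prod_subset_one_on_sdiff (Finset.subset_univ _) ?_ ?_
      · intro e he
        rw [if_pos]
        rw [Finset.card_eq_zero, Finset.filter_eq_empty_iff]
        rintro t - rfl
        simp at he
      · intro e he
        rw [if_neg]
        obtain ⟨t, -, rfl⟩ := Finset.mem_image.1 he
        exact Finset.card_ne_zero_of_mem (Finset.mem_filter.2 ⟨Finset.mem_univ t, rfl⟩)
    calc _ ≤ p * (p ^ (Finset.univ.image (walkEdge f g)).card *
          momentProd refMoment (walkEdge f g)) := by
          rw [← h1]; exact mul_le_mul_of_nonneg_left (hmom _) hp0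
      _ = p ^ ((Finset.univ.image (walkEdge f g)).card + 1) *
          momentProd refMoment (walkEdge f g) := by rw [pow_succ]; ring
      _ ≤ _ := by
          rw [← pow_add]
          exact mul_le_mul_of_nonneg_right
            (pow_le_pow_of_le_one hp0 hp1 (card_image_add_card_image_le_walkEdge f g))
            (momentProd_nonneg refMoment_nonneg _)
  have hLHS : p * ∫ ω, ((W ω * (W ω)ᵀ) ^ k).trace ∂μ ≤
      ∑ f : Fin (k + 1) → α, ∑ g : Fin k → β, p ^ (Finset.univ.image f).card *
        (p ^ (Finset.univ.image g).card * ((if f 0 = f (Fin.last k) then 1 else 0) *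
          momentProd refMoment (walkEdge f g))) := by
    simp_rw [trace_mul_transpose_pow]
    rw [integral_finsetSum _ fun f _ => integrable_finsetSum _ fun g _ =>
      (hwalk f g).1.const_mul _, Finset.mul_sum]
    refine Finset.sum_le_sum fun f _ => ?_
    rw [integral_finsetSum _ fun g _ => (hwalk f g).1.const_mul _, Finset.mul_sum]
    refine Finset.sum_le_sum fun g _ => ?_
    rw [integral_const_mul, mul_left_comm]
    calc _ ≤ (if f 0 = f (Fin.last k) then 1 else 0) * (p ^ (Finset.univ.image f).card *
          p ^ (Finset.univ.image g).card * momentProd refMoment (walkEdge f g)) :=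
          mul_le_mul_of_nonneg_left (hwalk f g).2 (hca0 f)
      _ = _ := by ring
  refine hLHS.trans ?_
  rw [sum_trace_refMatrix, Fintype.card_prod, Fintype.card_fin,
    mul_div_cancel_left₀ _ (by positivity), Finset.sum_comm]
  have hclosed : ∀ (f : Fin (k + 1) → α) (f' : Fin (k + 1) → Fin r), SameKernel f f' →
      (if f 0 = f (Fin.last k) then (1 : ℝ) else 0) = if f' 0 = f' (Fin.last k) then 1 else 0 :=
    fun f f' h => by simp only [h 0 (Fin.last k)]
  calc _ ≤ ∑ g : Fin k → β, ∑ f' : Fin (k + 1) → Fin r, p ^ (Finset.univ.image g).card *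
        ((if f' 0 = f' (Fin.last k) then 1 else 0) * momentProd refMoment (walkEdge f' g)) := by
        refine Finset.sum_le_sum fun g _ => ?_
        refine sum_pow_card_image_mul_le hp0 (by simpa using hα) (fun f' => ?_) fun f f' h => ?_
        · exact mul_nonneg (pow_nonneg hp0 _)
            (mul_nonneg (hcr0 f') (momentProd_nonneg refMoment_nonneg _))
        · rw [hclosed f f' h, (h.walkEdge (fun _ _ => Iff.rfl : SameKernel g g)).momentProd_eq]
    _ = ∑ f' : Fin (k + 1) → Fin r, ∑ g : Fin k → β, p ^ (Finset.univ.image g).card *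
        ((if f' 0 = f' (Fin.last k) then 1 else 0) * momentProd refMoment (walkEdge f' g)) :=
        Finset.sum_comm
    _ ≤ _ := by
        refine Finset.sum_le_sum fun f' _ => ?_
        refine sum_pow_card_image_mul_le hp0 (by simpa using hβ) (fun g' => ?_) fun g g' h => ?_
        · exact mul_nonneg (hcr0 f') (momentProd_nonneg refMoment_nonneg _)
        · rw [(SameKernel.walkEdge (fun _ _ => Iff.rfl : SameKernel f' f') h).momentProd_eq]

/-! ### A lattice net of the sphere -/

/-- The integer points in the ball of radius `(3/2) √r` of `ℝʳ`. -/
def latticeNet (r : ℕ) : Finset (Fin r → ℤ) :=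
  (Fintype.piFinset fun _ => Finset.Icc (-(3 * r : ℤ)) (3 * r)).filter
    fun z => 4 * ∑ i, z i ^ 2 ≤ 9 * r

lemma sum_half_pow_natAbs_le (L : ℤ) :
    ∑ z ∈ Finset.Icc (-L) L, (1 / 2 : ℝ) ^ z.natAbs ≤ 4 := by
  rw [← Finset.sum_fiberwise_of_maps_to (t := Finset.range (L.natAbs + 1)) (g := Int.natAbs)
    (fun z hz => by
      have := Finset.mem_Icc.1 hz
      exact Finset.mem_range.2 (by omega))]
  calc _ ≤ ∑ j ∈ Finset.range (L.natAbs + 1), 2 * (1 / 2 : ℝ) ^ j := by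
        refine Finset.sum_le_sum fun j _ => ?_
        rw [Finset.sum_congr rfl fun z hz => by rw [(Finset.mem_filter.1 hz).2],
          Finset.sum_const, nsmul_eq_mul]
        gcongr
        have hsub : (Finset.Icc (-L) L).filter (fun z => z.natAbs = j) ⊆ {(j : ℤ), -(j : ℤ)} := by
          intro z hz
          have := (Finset.mem_filter.1 hz).2
          simp only [Finset.mem_insert, Finset.mem_singleton]
          omega
        exact_mod_cast (Finset.card_le_card hsub).trans Finset.card_le_two
    _ ≤ 4 := by
        rw [← Finset.mul_sum]
        have := sum_geometric_two_le (L.natAbs + 1)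
        linarith

/-- A point of the net has `∑ |z i| ≤ ∑ (z i)² ≤ 3 r`, so the weights `8 ^ r * 2 ^ (-∑ |z i|)` are
at least one on it, and they sum over a box as a product of geometric series. -/
lemma card_latticeNet_le (r : ℕ) : ((latticeNet r).card : ℝ) ≤ 32 ^ r := by
  calc ((latticeNet r).card : ℝ) = ∑ z ∈ latticeNet r, (1 : ℝ) := by simp
    _ ≤ ∑ z ∈ latticeNet r, 8 ^ r * ∏ i, (1 / 2 : ℝ) ^ (z i).natAbs := by
        refine Finset.sum_le_sum fun z hz => ?_
        have hz' := (Finset.mem_filter.1 hz).2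
        have hle : ∑ i, (z i).natAbs ≤ 3 * r := by
          have h1 : ∀ i, ((z i).natAbs : ℤ) ≤ z i ^ 2 := by
            intro i
            have : (z i) ^ 2 = ((z i).natAbs : ℤ) ^ 2 := (Int.natAbs_sq (z i)).symm
            rw [this]
            exact_mod_cast Nat.le_self_pow two_ne_zero _
          have h2 := Finset.sum_le_sum fun i (_ : i ∈ Finset.univ) => h1 i
          have h3 : ((∑ i, (z i).natAbs : ℕ) : ℤ) ≤ ∑ i, z i ^ 2 := by push_cast; simpa using h2
          omega
        rw [Finset.prod_pow_eq_pow_sum]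
        calc (1 : ℝ) = 8 ^ r * (1 / 2) ^ (3 * r) := by
              rw [pow_mul, ← mul_pow]; norm_num
          _ ≤ _ := by
              gcongr 8 ^ r * ?_
              exact pow_le_pow_of_le_one (by norm_num) (by norm_num) hle
    _ ≤ ∑ z ∈ Fintype.piFinset fun _ : Fin r => Finset.Icc (-(3 * r : ℤ)) (3 * r),
          8 ^ r * ∏ i, (1 / 2 : ℝ) ^ (z i).natAbs :=
        Finset.sum_le_sum_of_subset_of_nonneg (Finset.filter_subset _ _) fun _ _ _ => by positivity
    _ = 8 ^ r * ∏ _i : Fin r, ∑ z ∈ Finset.Icc (-(3 * r : ℤ)) (3 * r), (1 / 2 : ℝ) ^ z.natAbs := by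
        rw [← Finset.mul_sum, Finset.prod_univ_sum]
    _ ≤ 8 ^ r * ∏ _i : Fin r, 4 := by
        gcongr 8 ^ r * ?_
        exact Finset.prod_le_prod (fun i _ => Finset.sum_nonneg fun _ _ => by positivity)
          fun i _ => sum_half_pow_natAbs_le _
    _ = 32 ^ r := by
        rw [Finset.prod_const, Finset.card_univ, Fintype.card_fin, ← mul_pow]; norm_num

/-- Rounding the coordinates of a point of the ball of radius `√r`. -/
lemma exists_mem_latticeNet {r : ℕ} {u : Fin r → ℝ} (hu : ‖toLp 2 u‖ ≤ Real.sqrt r) :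
    ∃ z ∈ latticeNet r, ‖toLp 2 (u - fun i => (z i : ℝ))‖ ≤ Real.sqrt r / 2 := by
  have hd : ‖toLp 2 (u - fun i => (round (u i) : ℝ))‖ ≤ Real.sqrt r / 2 := by
    refine abs_le_of_sq_le_sq' ?_ (by positivity) |>.2
    rw [norm_toLp_sq, div_pow, Real.sq_sqrt (by positivity)]
    calc ∑ i, (u - fun i => (round (u i) : ℝ)) i ^ 2 ≤ ∑ _i : Fin r, (1 / 2 : ℝ) ^ 2 := by
          refine Finset.sum_le_sum fun i _ => ?_
          exact sq_le_sq' (abs_le.1 (abs_sub_round (u i))).1 (abs_le.1 (abs_sub_round (u i))).2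
      _ = r / 2 ^ 2 := by simp; ring
  have hz : ‖toLp 2 (fun i => (round (u i) : ℝ))‖ ≤ 3 / 2 * Real.sqrt r := by
    have : toLp 2 (fun i => (round (u i) : ℝ)) =
        toLp 2 u - toLp 2 (u - fun i => (round (u i) : ℝ)) := by
      rw [← WithLp.toLp_sub, sub_sub_cancel]
    rw [this]
    refine (norm_sub_le _ _).trans ?_
    linarith
  have hz2 : ∑ i, (round (u i) : ℝ) ^ 2 ≤ 9 / 4 * r := by
    rw [← norm_toLp_sq]
    calc _ ≤ (3 / 2 * Real.sqrt r) ^ 2 := by gcongr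
      _ = _ := by rw [mul_pow, Real.sq_sqrt (by positivity)]; norm_num
  have hz3 : 4 * ∑ i, (round (u i)) ^ 2 ≤ 9 * (r : ℤ) := by
    have : (4 * ∑ i, (round (u i) : ℝ) ^ 2) ≤ 9 * r := by linarith
    exact_mod_cast this
  refine ⟨fun i => round (u i), ?_, hd⟩
  refine Finset.mem_filter.2 ⟨Fintype.mem_piFinset.2 fun i => ?_, hz3⟩
  have h1 : round (u i) ^ 2 ≤ ∑ i, round (u i) ^ 2 :=
    Finset.single_le_sum (f := fun i => round (u i) ^ 2) (fun _ _ => sq_nonneg _)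
      (Finset.mem_univ i)
  have hr : (1 : ℤ) ≤ r := by
    have := i.pos
    omega
  exact Finset.mem_Icc.2 (abs_le.1 (abs_le_of_sq_le_sq (by nlinarith) (by positivity)))

/-- The net has mesh `√r / 2` at scale `√r`, so passing to it costs a factor two in either argument
of the bilinear form. -/
lemma mul_opNorm_le_of_latticeNet {r : ℕ} (Y : Matrix (Fin r) (Fin r) ℝ) {B : ℝ} (hB0 : 0 ≤ B)
    (hB : ∀ z ∈ latticeNet r, ∀ z' ∈ latticeNet r,
      |(fun i => (z i : ℝ)) ⬝ᵥ Y *ᵥ (fun i => (z' i : ℝ))| ≤ B) : r * ‖Y‖ ≤ 4 * B := by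
  rcases Nat.eq_zero_or_pos r with rfl | hr
  · simp; positivity
  have hr0 : 0 < Real.sqrt r := Real.sqrt_pos.2 (by exact_mod_cast hr)
  have hdot : ∀ a b : Fin r → ℝ, |a ⬝ᵥ b| ≤ ‖toLp 2 a‖ * ‖toLp 2 b‖ := by
    intro a b
    have := abs_real_inner_le_norm (toLp 2 b) (toLp 2 a)
    rw [PiLp.inner_apply] at this
    simpa [dotProduct, mul_comm] using this
  have h1 : ∀ z ∈ latticeNet r, Real.sqrt r * ‖toLp 2 (Y *ᵥ fun i => (z i : ℝ))‖ ≤ 2 * B := by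
    intro z hz
    set w := Y *ᵥ fun i => (z i : ℝ) with hw
    rcases eq_or_ne ‖toLp 2 w‖ 0 with h0 | h0
    · rw [h0]; linarith
    set u : Fin r → ℝ := (Real.sqrt r / ‖toLp 2 w‖) • w with hu
    have hun : ‖toLp 2 u‖ = Real.sqrt r := by
      rw [hu, WithLp.toLp_smul, norm_smul, Real.norm_of_nonneg (by positivity),
        div_mul_cancel₀ _ h0]
    obtain ⟨z', hz', hd⟩ := exists_mem_latticeNet hun.le
    have huw : u ⬝ᵥ w = Real.sqrt r * ‖toLp 2 w‖ := by
      have : w ⬝ᵥ w = ‖toLp 2 w‖ ^ 2 := by rw [norm_toLp_sq]; simp [dotProduct, sq]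
      rw [hu, smul_dotProduct, this, smul_eq_mul]
      field_simp
    have hsplit : u ⬝ᵥ w = (fun i => (z' i : ℝ)) ⬝ᵥ w + (u - fun i => (z' i : ℝ)) ⬝ᵥ w := by
      rw [← add_dotProduct]; congr 1; abel
    have h2 := (le_abs_self _).trans (hB z' hz' z hz)
    have h3 := (le_abs_self _).trans (hdot (u - fun i => (z' i : ℝ)) w)
    have h4 : ‖toLp 2 (u - fun i => (z' i : ℝ))‖ * ‖toLp 2 w‖ ≤ Real.sqrt r / 2 * ‖toLp 2 w‖ := by
      gcongr
    linarith
  have h2 : ‖Y‖ ≤ (2 * B / Real.sqrt r + ‖Y‖ * (Real.sqrt r / 2)) / Real.sqrt r := by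
    refine opNorm_le_of_mulVec Y (by positivity) fun x => ?_
    rcases eq_or_ne ‖toLp 2 x‖ 0 with h0 | h0
    · have := norm_toLp_mulVec_le Y x
      rw [h0, mul_zero] at this ⊢
      exact this
    set u : Fin r → ℝ := (Real.sqrt r / ‖toLp 2 x‖) • x with hu
    have hun : ‖toLp 2 u‖ = Real.sqrt r := by
      rw [hu, WithLp.toLp_smul, norm_smul, Real.norm_of_nonneg (by positivity),
        div_mul_cancel₀ _ h0]
    obtain ⟨z, hz, hd⟩ := exists_mem_latticeNet hun.le
    have hYu : ‖toLp 2 (Y *ᵥ u)‖ = Real.sqrt r / ‖toLp 2 x‖ * ‖toLp 2 (Y *ᵥ x)‖ := by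
      rw [hu, Matrix.mulVec_smul, WithLp.toLp_smul, norm_smul, Real.norm_of_nonneg (by positivity)]
    have hsplit : Y *ᵥ u = Y *ᵥ (fun i => (z i : ℝ)) + Y *ᵥ (u - fun i => (z i : ℝ)) := by
      rw [← Matrix.mulVec_add]; congr 1; abel
    have h3 : ‖toLp 2 (Y *ᵥ u)‖ ≤ 2 * B / Real.sqrt r + ‖Y‖ * (Real.sqrt r / 2) := by
      rw [hsplit, WithLp.toLp_add]
      refine (norm_add_le _ _).trans (add_le_add ?_ ?_)
      · rw [le_div_iff₀ hr0, mul_comm]; exact h1 z hz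
      · exact (norm_toLp_mulVec_le _ _).trans (by gcongr)
    have hx0 : 0 < ‖toLp 2 x‖ := lt_of_le_of_ne (norm_nonneg _) h0.symm
    calc ‖toLp 2 (Y *ᵥ x)‖ = ‖toLp 2 (Y *ᵥ u)‖ / Real.sqrt r * ‖toLp 2 x‖ := by
          rw [hYu]; field_simp
      _ ≤ _ := by gcongr
  rw [le_div_iff₀ hr0] at h2
  have h3 : ‖Y‖ * Real.sqrt r / 2 ≤ 2 * B / Real.sqrt r := by linarith
  rw [le_div_iff₀ hr0] at h3
  have h4 : Real.sqrt r * Real.sqrt r = r := Real.mul_self_sqrt (by positivity)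
  have h5 : ‖Y‖ * Real.sqrt r / 2 * Real.sqrt r = ‖Y‖ * (Real.sqrt r * Real.sqrt r) / 2 := by ring
  rw [h5, h4] at h3
  linarith

/-! ### Trace moments of the reference ensemble -/

lemma exp_le_add_exp_sq (x : ℝ) : Real.exp x ≤ x + Real.exp (x ^ 2) := by
  have h1 := Real.add_one_le_exp (x ^ 2)
  rcases le_or_gt |x| 1 with h | h
  · have h2 := (abs_le.1 (Real.abs_exp_sub_one_sub_id_le h)).2
    linarith
  · rcases lt_abs.1 h with h | h
    · have : Real.exp x ≤ Real.exp (x ^ 2) := Real.exp_le_exp.2 (by nlinarith)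
      linarith
    · have : Real.exp x ≤ 1 := Real.exp_le_one_iff.2 (by linarith)
      nlinarith

/-- The entries of the reference matrix are subgaussian. -/
lemma sum_exp_mul_refValue_le (b : ℝ) :
    ∑ a, Real.exp (b * refValue a) ≤ 3 * Real.exp (4 * b ^ 2) := by
  have h1 := exp_le_add_exp_sq (b * 2)
  have h2 := exp_le_add_exp_sq (b * -1)
  have h3 : Real.exp ((b * -1) ^ 2) ≤ Real.exp (4 * b ^ 2) :=
    Real.exp_le_exp.2 (by nlinarith [sq_nonneg b])
  have h4 : (b * 2) ^ 2 = 4 * b ^ 2 := by ring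
  rw [h4] at h1
  simp only [Fin.sum_univ_three, refValue, Matrix.cons_val_zero, Matrix.cons_val_one,
    Matrix.cons_val]
  linarith

lemma sum_exp_dotProduct_refMatrix_le {r : ℕ} (c : ℝ) (x y : Fin r → ℝ) :
    ∑ ω : Fin r × Fin r → Fin 3, Real.exp (c * (x ⬝ᵥ refMatrix ω *ᵥ y)) ≤
      3 ^ (r * r) * Real.exp (4 * c ^ 2 * (∑ i, x i ^ 2) * ∑ j, y j ^ 2) := by
  have h1 : ∀ ω : Fin r × Fin r → Fin 3, Real.exp (c * (x ⬝ᵥ refMatrix ω *ᵥ y)) =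
      ∏ e, Real.exp (c * x e.1 * y e.2 * refValue (ω e)) := by
    intro ω
    rw [← Real.exp_sum, Fintype.sum_prod_type]
    congr 1
    simp only [dotProduct, Matrix.mulVec, refMatrix, Matrix.of_apply, Finset.mul_sum]
    exact Finset.sum_congr rfl fun i _ => Finset.sum_congr rfl fun j _ => by ring
  simp_rw [h1]
  rw [← Fintype.piFinset_univ, ← Finset.prod_univ_sum (fun _ => Finset.univ)
    (fun (e : Fin r × Fin r) (a : Fin 3) => Real.exp (c * x e.1 * y e.2 * refValue a))]
  calc _ ≤ ∏ e : Fin r × Fin r, 3 * Real.exp (4 * (c * x e.1 * y e.2) ^ 2) :=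
        Finset.prod_le_prod (fun e _ => Finset.sum_nonneg fun _ _ => (Real.exp_pos _).le)
          fun e _ => sum_exp_mul_refValue_le _
    _ = _ := by
        rw [Finset.prod_mul_distrib, Finset.prod_const, ← Real.exp_sum, Fintype.sum_prod_type,
          Finset.card_univ, Fintype.card_prod, Fintype.card_fin]
        congr 2
        rw [mul_assoc, Finset.sum_mul_sum, Finset.mul_sum]
        refine Finset.sum_congr rfl fun i _ => ?_
        rw [Finset.mul_sum]
        exact Finset.sum_congr rfl fun j _ => by ring

lemma sum_dotProduct_refMatrix_pow_le {r : ℕ} (hr : 0 < r) (k : ℕ) {x y : Fin r → ℝ}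
    (hx : ∑ i, x i ^ 2 ≤ 9 / 4 * r) (hy : ∑ i, y i ^ 2 ≤ 9 / 4 * r) :
    ∑ ω : Fin r × Fin r → Fin 3, (x ⬝ᵥ refMatrix ω *ᵥ y) ^ (2 * k) ≤
      3 ^ (r * r) * (r ^ k * (2 * k).factorial * (2 * Real.exp (21 * r))) := by
  have hr0 : (0 : ℝ) < r := by exact_mod_cast hr
  -- The exponential moment at this scale is of the same order `exp (O(r))` as the size of the net.
  set c : ℝ := (Real.sqrt r)⁻¹ with hc
  have hc2 : c ^ 2 = (r : ℝ)⁻¹ := by rw [hc, inv_pow, Real.sq_sqrt hr0.le]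
  have hexp : ∀ c' : ℝ, c' ^ 2 = (r : ℝ)⁻¹ →
      ∑ ω : Fin r × Fin r → Fin 3, Real.exp (c' * (x ⬝ᵥ refMatrix ω *ᵥ y)) ≤
        3 ^ (r * r) * Real.exp (21 * r) := by
    intro c' hc'
    refine (sum_exp_dotProduct_refMatrix_le c' x y).trans ?_
    refine mul_le_mul_of_nonneg_left (Real.exp_le_exp.2 ?_) (by positivity)
    rw [hc']
    have hx0 : 0 ≤ ∑ i, x i ^ 2 := by positivity
    have hy0 : 0 ≤ ∑ i, y i ^ 2 := by positivity
    calc 4 * (r : ℝ)⁻¹ * (∑ i, x i ^ 2) * ∑ j, y j ^ 2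
        ≤ 4 * (r : ℝ)⁻¹ * (9 / 4 * r) * (9 / 4 * r) := by gcongr
      _ = 81 / 4 * r := by field_simp; norm_num
      _ ≤ 21 * r := by linarith
  have hpt : ∀ b : ℝ, b ^ (2 * k) ≤ r ^ k * (2 * k).factorial *
      (Real.exp (c * b) + Real.exp (-c * b)) := by
    intro b
    have h1 := Real.pow_div_factorial_le_exp |c * b| (abs_nonneg _) (2 * k)
    have h2 : |c * b| ^ (2 * k) = ((r : ℝ) ^ k)⁻¹ * b ^ (2 * k) := by
      rw [Even.pow_abs (even_two_mul k), mul_pow, pow_mul c, hc2, inv_pow]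
    have h3 : Real.exp |c * b| ≤ Real.exp (c * b) + Real.exp (-c * b) := by
      rcases abs_cases (c * b) with ⟨h, -⟩ | ⟨h, -⟩ <;> rw [h]
      · linarith [Real.exp_pos (-c * b)]
      · rw [neg_mul]; linarith [Real.exp_pos (c * b)]
    rw [h2, div_le_iff₀ (by positivity)] at h1
    calc b ^ (2 * k) = (r : ℝ) ^ k * (((r : ℝ) ^ k)⁻¹ * b ^ (2 * k)) := by
          field_simp
      _ ≤ (r : ℝ) ^ k * (Real.exp |c * b| * (2 * k).factorial) := by gcongr
      _ ≤ (r : ℝ) ^ k * ((Real.exp (c * b) + Real.exp (-c * b)) * (2 * k).factorial) := by gcongr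
      _ = _ := by ring
  calc _ ≤ ∑ ω : Fin r × Fin r → Fin 3, r ^ k * (2 * k).factorial *
        (Real.exp (c * (x ⬝ᵥ refMatrix ω *ᵥ y)) + Real.exp (-c * (x ⬝ᵥ refMatrix ω *ᵥ y))) :=
        Finset.sum_le_sum fun ω _ => hpt _
    _ = r ^ k * (2 * k).factorial *
        (∑ ω : Fin r × Fin r → Fin 3, Real.exp (c * (x ⬝ᵥ refMatrix ω *ᵥ y))
        + ∑ ω : Fin r × Fin r → Fin 3, Real.exp (-c * (x ⬝ᵥ refMatrix ω *ᵥ y))) := by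
        rw [← Finset.mul_sum, Finset.sum_add_distrib]
    _ ≤ r ^ k * (2 * k).factorial * (3 ^ (r * r) * Real.exp (21 * r) +
        3 ^ (r * r) * Real.exp (21 * r)) := by
        gcongr
        · exact hexp c hc2
        · exact hexp (-c) (by rw [neg_sq, hc2])
    _ = _ := by ring

lemma sum_opNorm_refMatrix_pow_le {r : ℕ} (hr : 0 < r) (k : ℕ) :
    ∑ ω : Fin r × Fin r → Fin 3, (r * ‖refMatrix ω‖) ^ (2 * k) ≤
      3 ^ (r * r) * (16 ^ k * (32 ^ r * 32 ^ r) *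
        (r ^ k * (2 * k).factorial * (2 * Real.exp (21 * r)))) := by
  have hnet : ∀ z ∈ latticeNet r, ∑ i, ((z i : ℝ)) ^ 2 ≤ 9 / 4 * r := by
    intro z hz
    have h1 : (4 * ∑ i, (z i : ℝ) ^ 2) ≤ 9 * r := by exact_mod_cast (Finset.mem_filter.1 hz).2
    linarith
  have h0 : (0 : Fin r → ℤ) ∈ latticeNet r :=
    Finset.mem_filter.2 ⟨Fintype.mem_piFinset.2 fun i => by simp, by simp⟩
  have hpt : ∀ Y : Matrix (Fin r) (Fin r) ℝ, (r * ‖Y‖) ^ (2 * k) ≤ 16 ^ k *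
      ∑ q ∈ latticeNet r ×ˢ latticeNet r,
        ((fun i => (q.1 i : ℝ)) ⬝ᵥ Y *ᵥ (fun i => (q.2 i : ℝ))) ^ (2 * k) := by
    intro Y
    set b : (Fin r → ℤ) × (Fin r → ℤ) → ℝ :=
      fun q => (fun i => (q.1 i : ℝ)) ⬝ᵥ Y *ᵥ (fun i => (q.2 i : ℝ)) with hb
    obtain ⟨q, hq, hmax⟩ := Finset.exists_max_image (latticeNet r ×ˢ latticeNet r) (fun q => |b q|)
      ⟨(0, 0), Finset.mem_product.2 ⟨h0, h0⟩⟩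
    have h1 := mul_opNorm_le_of_latticeNet Y (abs_nonneg (b q)) fun z hz z' hz' =>
      hmax (z, z') (Finset.mem_product.2 ⟨hz, hz'⟩)
    calc (r * ‖Y‖) ^ (2 * k) ≤ (4 * |b q|) ^ (2 * k) := by gcongr
      _ = 16 ^ k * b q ^ (2 * k) := by
          rw [mul_pow, Even.pow_abs (even_two_mul k), pow_mul]; norm_num
      _ ≤ _ := by
          gcongr
          exact Finset.single_le_sum (f := fun q => b q ^ (2 * k))
            (fun q _ => (even_two_mul k).pow_nonneg _) hq
  calc _ ≤ ∑ ω : Fin r × Fin r → Fin 3, 16 ^ k * ∑ q ∈ latticeNet r ×ˢ latticeNet r,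
        ((fun i => (q.1 i : ℝ)) ⬝ᵥ refMatrix ω *ᵥ (fun i => (q.2 i : ℝ))) ^ (2 * k) :=
        Finset.sum_le_sum fun ω _ => hpt _
    _ = 16 ^ k * ∑ q ∈ latticeNet r ×ˢ latticeNet r, ∑ ω : Fin r × Fin r → Fin 3,
        ((fun i => (q.1 i : ℝ)) ⬝ᵥ refMatrix ω *ᵥ (fun i => (q.2 i : ℝ))) ^ (2 * k) := by
        rw [← Finset.mul_sum, Finset.sum_comm]
    _ ≤ 16 ^ k * ∑ q ∈ latticeNet r ×ˢ latticeNet r, 3 ^ (r * r) *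
        (r ^ k * (2 * k).factorial * (2 * Real.exp (21 * r))) := by
        gcongr with q hq
        have hq' := Finset.mem_product.1 hq
        exact sum_dotProduct_refMatrix_pow_le hr k (hnet _ hq'.1) (hnet _ hq'.2)
    _ = 3 ^ (r * r) * (16 ^ k * ((latticeNet r).card * (latticeNet r).card) *
        (r ^ k * (2 * k).factorial * (2 * Real.exp (21 * r)))) := by
        rw [Finset.sum_const, Finset.card_product, nsmul_eq_mul]; push_cast; ring
    _ ≤ _ := by
        have := card_latticeNet_le r
        gcongr

lemma abs_apply_le_opNorm {α β : Type*} [Fintype α] [Fintype β] [DecidableEq β] (M : Matrix α β ℝ)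
    (i : α) (j : β) : |M i j| ≤ ‖M‖ := by
  have h := norm_toLp_mulVec_le M (Pi.single j 1)
  have h1 : ‖toLp 2 (Pi.single j (1 : ℝ) : β → ℝ)‖ = 1 := by
    simp
  rw [h1, mul_one, Matrix.mulVec_single_one] at h
  refine le_trans ?_ h
  exact PiLp.norm_apply_le (toLp 2 (M.col j)) i

lemma trace_mul_transpose_pow_le {α β : Type*} [Fintype α] [Fintype β] [DecidableEq α]
    [DecidableEq β] (Y : Matrix α β ℝ) {k : ℕ} (hk : 0 < k) :
    ((Y * Yᵀ) ^ k).trace ≤ Fintype.card α * ‖Y‖ ^ (2 * k) := by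
  have h1 : ‖(Y * Yᵀ) ^ k‖ ≤ ‖Y‖ ^ (2 * k) := by
    refine (norm_pow_le' _ hk).trans ?_
    rw [pow_mul, sq]
    gcongr
    exact (Matrix.l2_opNorm_mul _ _).trans_eq (by rw [opNorm_transpose])
  calc ((Y * Yᵀ) ^ k).trace ≤ ∑ _i : α, ‖Y‖ ^ (2 * k) :=
        Finset.sum_le_sum fun i _ => (le_abs_self _).trans ((abs_apply_le_opNorm _ i i).trans h1)
    _ = _ := by simp

/-- For powers of two the trace moment dominates the operator norm. -/
lemma opNorm_pow_le_trace {α β : Type*} [Fintype α] [Fintype β] [DecidableEq α]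
    [DecidableEq β] (Y : Matrix α β ℝ) (j : ℕ) :
    ‖Y‖ ^ (2 * 2 ^ (j + 1)) ≤ ((Y * Yᵀ) ^ 2 ^ (j + 1)).trace := by
  set S := (Y * Yᵀ) ^ 2 ^ j with hS
  have hsa : IsSelfAdjoint (Y * Yᵀ) := by
    rw [IsSelfAdjoint, Matrix.star_eq_conjTranspose, Matrix.conjTranspose_eq_transpose_of_trivial]
    simp
  have hS1 : ‖S‖ = ‖Y‖ ^ (2 * 2 ^ j) := by
    have h1 := Matrix.l2_opNorm_conjTranspose_mul_self Yᵀ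
    rw [Matrix.conjTranspose_eq_transpose_of_trivial, Matrix.transpose_transpose,
      opNorm_transpose] at h1
    rw [hS, hsa.norm_pow_two_pow, h1, pow_mul, sq]
  have hST : Sᵀ = S := by rw [hS, Matrix.transpose_pow]; simp
  have htr : ((Y * Yᵀ) ^ 2 ^ (j + 1)).trace = frobNorm S ^ 2 := by
    have : (Y * Yᵀ) ^ 2 ^ (j + 1) = S * Sᵀ := by rw [hST, hS, ← pow_add]; congr 1; ring
    rw [this, frobNorm_sq]
    simp [Matrix.trace, Matrix.mul_apply, sq]
  rw [htr]
  calc ‖Y‖ ^ (2 * 2 ^ (j + 1)) = ‖S‖ ^ 2 := by rw [hS1, ← pow_mul]; congr 1; ring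
    _ ≤ _ := by gcongr; exact opNorm_le_frobNorm S

/-- The mean of the trace moment of order `2 * k` of a reference matrix of size `2 * k + 1`. -/
lemma sum_trace_refMatrix_le {k r : ℕ} (hk : 0 < k) (hr : r = 2 * k + 1) :
    (∑ ω : Fin r × Fin r → Fin 3, ((refMatrix ω * (refMatrix ω)ᵀ) ^ k).trace) / 3 ^ (r * r) ≤
      (Real.exp 110 * k) ^ k := by
  have hr0 : (0 : ℝ) < r := by rw [hr]; positivity
  have hk1 : (1 : ℝ) ≤ k := by exact_mod_cast hk
  have hr3 : (r : ℝ) ≤ 3 * k := by rw [hr]; push_cast; linarith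
  have hkr : (2 * k : ℝ) ≤ r := by rw [hr]; push_cast; linarith
  have h1 := sum_opNorm_refMatrix_pow_le (r := r) (by omega) k
  have h2 : ∑ ω : Fin r × Fin r → Fin 3, ((refMatrix ω * (refMatrix ω)ᵀ) ^ k).trace ≤
      r * ((r : ℝ) ^ (2 * k))⁻¹ * ∑ ω : Fin r × Fin r → Fin 3, (r * ‖refMatrix ω‖) ^ (2 * k) := by
    rw [Finset.mul_sum]
    refine Finset.sum_le_sum fun ω _ => (trace_mul_transpose_pow_le _ hk).trans_eq ?_
    rw [Fintype.card_fin, mul_pow]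
    field_simp
  have hfac : ((2 * k).factorial : ℝ) ≤ r ^ k * (2 * k) ^ k := by
    calc ((2 * k).factorial : ℝ) ≤ ((2 * k : ℕ) : ℝ) ^ (2 * k) := by
          exact_mod_cast Nat.factorial_le_pow _
      _ = (2 * k) ^ k * (2 * k) ^ k := by push_cast; rw [← pow_add]; congr 1; ring
      _ ≤ _ := by gcongr
  have he2 : (2 : ℝ) ≤ Real.exp 1 := by linarith [Real.add_one_le_exp (1 : ℝ)]
  have h32 : (32 : ℝ) ≤ Real.exp 5 := by
    calc (32 : ℝ) = 2 ^ 5 := by norm_num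
      _ ≤ Real.exp 1 ^ 5 := by gcongr
      _ = Real.exp 5 := by rw [← Real.exp_nat_mul]; norm_num
  have hpow : ∀ (x : ℝ) (j : ℕ), Real.exp x ^ j = Real.exp (x * j) :=
    fun x j => by rw [← Real.exp_nat_mul, mul_comm]
  rw [div_le_iff₀ (by positivity)]
  calc _ ≤ r * ((r : ℝ) ^ (2 * k))⁻¹ * (3 ^ (r * r) * (16 ^ k * (32 ^ r * 32 ^ r) *
        (r ^ k * (2 * k).factorial * (2 * Real.exp (21 * r))))) := h2.trans (by gcongr)
    _ ≤ r * ((r : ℝ) ^ (2 * k))⁻¹ * (3 ^ (r * r) * (16 ^ k * (32 ^ r * 32 ^ r) *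
        (r ^ k * (r ^ k * (2 * k) ^ k) * (2 * Real.exp (21 * r))))) := by gcongr
    _ = (2 * r) * (32 ^ k * (32 ^ r * 32 ^ r) * Real.exp (21 * r)) * k ^ k * 3 ^ (r * r) := by
        have e1 : (r : ℝ) ^ (2 * k) = r ^ k * r ^ k := by rw [two_mul, pow_add]
        have e2 : (32 : ℝ) ^ k = 16 ^ k * 2 ^ k := by rw [← mul_pow]; norm_num
        rw [e1, e2, mul_pow]
        field_simp
    _ ≤ Real.exp (6 * k) * (Real.exp 5 ^ k * (Real.exp 5 ^ r * Real.exp 5 ^ r) *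
        Real.exp (21 * r)) * k ^ k * 3 ^ (r * r) := by
        gcongr
        linarith [Real.add_one_le_exp (6 * (k : ℝ))]
    _ = Real.exp (11 * k + 31 * r) * k ^ k * 3 ^ (r * r) := by
        rw [hpow, hpow, ← Real.exp_add, ← Real.exp_add, ← Real.exp_add, ← Real.exp_add]
        congr 3
        ring
    _ ≤ Real.exp (110 * k) * k ^ k * 3 ^ (r * r) := by
        gcongr
        linarith
    _ = _ := by rw [mul_pow, hpow]

/-! ### Operator norm of a sparse random matrix -/

/-- A random matrix with independent centred entries in `[-1, 1]` of variance at most `p` has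
operator norm `O(√x)` outside a set of probability `e⁻²ˣ / p`, as soon as `x` bounds the expected
row and column sums of squares. -/
lemma exists_opNorm_le {Ω α β : Type*} [MeasurableSpace Ω] {μ : Measure Ω} [Fintype α]
    [DecidableEq α] [Fintype β] [DecidableEq β] {W : Ω → Matrix α β ℝ} {p : ℝ} (hp0 : 0 < p)
    (hp1 : p ≤ 1)
    (hint : ∀ m : α × β → ℕ, Integrable (fun ω => ∏ e, W ω e.1 e.2 ^ m e) μ)
    (hmom : ∀ m : α × β → ℕ, ∫ ω, ∏ e, W ω e.1 e.2 ^ m e ∂μ ≤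
      ∏ e, if m e = 0 then 1 else p * refMoment (m e))
    {x : ℝ} (hx1 : 1 ≤ x) (hα : p * Fintype.card α ≤ x) (hβ : p * Fintype.card β ≤ x) :
    ∃ S : Set Ω, μ.real S ≤ Real.exp (-2 * x) / p ∧
      ∀ ω ∉ S, ‖W ω‖ ≤ Real.exp 57 * Real.sqrt x := by
  obtain ⟨j, hj1, hj2⟩ := exists_nat_pow_near hx1 (one_lt_two (α := ℝ))
  -- A power of two of the order of `x`; the reference matrix then has size `2 * k + 1`.
  set k : ℕ := 2 ^ (j + 1) with hk
  have hk0 : 0 < k := by positivity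
  have hkx : x ≤ k := by rw [hk]; push_cast; exact hj2.le
  have hkx2 : (k : ℝ) ≤ 2 * x := by rw [hk]; push_cast; rw [pow_succ]; linarith
  have hcomp := mul_integral_trace_le hp0.le hp1 hint hmom (r := 2 * k + 1) hk0
    (by push_cast; linarith) (by push_cast; linarith)
  have hmain := hcomp.trans (sum_trace_refMatrix_le hk0 rfl)
  -- The threshold exceeds the bound on the moment by the factor `exp (2 * k)`.
  set t : ℝ := (Real.exp 112 * k) ^ k with ht
  have ht0 : 0 < t := by rw [ht]; positivity
  have hintT : Integrable (fun ω => ((W ω * (W ω)ᵀ) ^ k).trace) μ := by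
    simp_rw [trace_mul_transpose_pow]
    refine integrable_finsetSum _ fun f _ => integrable_finsetSum _ fun g _ => ?_
    simp_rw [fun ω => prod_comp_eq_prod_pow (fun e : α × β => W ω e.1 e.2) (walkEdge f g)]
    exact (hint _).const_mul _
  have htr : ∀ ω, ‖W ω‖ ^ (2 * k) ≤ ((W ω * (W ω)ᵀ) ^ k).trace := fun ω => opNorm_pow_le_trace _ j
  have hmarkov := mul_meas_ge_le_integral_of_nonneg
    (Filter.Eventually.of_forall fun ω => le_trans (by positivity) (htr ω)) hintT t
  refine ⟨{ω | t ≤ ((W ω * (W ω)ᵀ) ^ k).trace}, ?_, fun ω hω => ?_⟩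
  · rw [le_div_iff₀ hp0]
    have h1 : t = Real.exp (2 * k) * (Real.exp 110 * k) ^ k := by
      have e1 : Real.exp 112 = Real.exp 2 * Real.exp 110 := by rw [← Real.exp_add]; norm_num
      rw [ht, e1, mul_assoc, mul_pow, ← Real.exp_nat_mul, mul_comm (k : ℝ) 2]
    set q := μ.real {ω | t ≤ ((W ω * (W ω)ᵀ) ^ k).trace} with hq
    have hq0 : 0 ≤ q := measureReal_nonneg
    have hD : 0 < (Real.exp 110 * (k : ℝ)) ^ k := by positivity
    have h2 : (Real.exp (2 * k) * (q * p)) * (Real.exp 110 * (k : ℝ)) ^ k ≤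
        1 * (Real.exp 110 * (k : ℝ)) ^ k := by
      calc _ = p * (t * q) := by rw [h1]; ring
        _ ≤ p * ∫ ω, ((W ω * (W ω)ᵀ) ^ k).trace ∂μ := by gcongr
        _ ≤ _ := by rw [one_mul]; exact hmain
    have h3 := le_of_mul_le_mul_right h2 hD
    calc q * p = Real.exp (-(2 * k)) * (Real.exp (2 * k) * (q * p)) := by
          rw [← mul_assoc, ← Real.exp_add]; simp
      _ ≤ Real.exp (-(2 * k)) * 1 := by gcongr
      _ ≤ Real.exp (-2 * x) := by rw [mul_one]; gcongr; linarith
  · have h1 : ‖W ω‖ ^ (2 * k) ≤ t := (htr ω).trans (not_le.1 hω).le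
    rw [pow_mul, ht] at h1
    have h2 : ‖W ω‖ ^ 2 ≤ Real.exp 112 * k :=
      le_of_pow_le_pow_left₀ hk0.ne' (by positivity) h1
    refine abs_le_of_sq_le_sq' ?_ (by positivity) |>.2
    rw [mul_pow, Real.sq_sqrt (by linarith), ← Real.exp_nat_mul]
    have he2 : (2 : ℝ) ≤ Real.exp 2 := by linarith [Real.add_one_le_exp (2 : ℝ)]
    calc ‖W ω‖ ^ 2 ≤ Real.exp 112 * (2 * x) := h2.trans (by gcongr)
      _ ≤ Real.exp 112 * (Real.exp 2 * x) := by gcongr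
      _ = Real.exp (((2 : ℕ) : ℝ) * 57) * x := by
          rw [← mul_assoc, ← Real.exp_add]; norm_num

/-! ### Noise of an inhomogeneous Erdős–Rényi network -/

/-- Mixed moments of independent centred variables in `[-1, 1]` of variance at most `p`; the
variables with index outside `S` are identically zero. -/
lemma integral_prod_pow_le {Ω κ : Type*} [MeasurableSpace Ω] {μ : Measure Ω}
    [IsProbabilityMeasure μ] [Fintype κ] {S : κ → Prop} [DecidablePred S] {Z : {e // S e} → Ω → ℝ}
    {V : Ω → κ → ℝ} {p : ℝ}
    (hp0 : 0 ≤ p) (hZ : iIndepFun Z μ) (hZm : ∀ e, Measurable (Z e)) (hZ1 : ∀ e ω, |Z e ω| ≤ 1)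
    (hZ0 : ∀ e, ∫ ω, Z e ω ∂μ = 0) (hZ2 : ∀ e, ∫ ω, Z e ω ^ 2 ∂μ ≤ p)
    (hVS : ∀ e : {e // S e}, ∀ ω, V ω e = Z e ω) (hV0 : ∀ e, ¬ S e → ∀ ω, V ω e = 0)
    (m : κ → ℕ) :
    Integrable (fun ω => ∏ e, V ω e ^ m e) μ ∧
      ∫ ω, ∏ e, V ω e ^ m e ∂μ ≤ ∏ e, if m e = 0 then 1 else p * refMoment (m e) := by
  have hV1 : ∀ ω e, |V ω e| ≤ 1 := by
    intro ω e
    by_cases he : S e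
    · rw [hVS ⟨e, he⟩]; exact hZ1 _ _
    · rw [hV0 e he]; simp
  have hVm : ∀ e, Measurable fun ω => V ω e := by
    intro e
    by_cases he : S e
    · simp_rw [hVS ⟨e, he⟩]; exact hZm _
    · simp_rw [hV0 e he]; exact measurable_const
  have hfac0 : ∀ j : ℕ, 0 ≤ if j = 0 then 1 else p * refMoment j := by
    intro j
    split_ifs
    · exact zero_le_one
    · exact mul_nonneg hp0 (refMoment_nonneg j)
  refine ⟨?_, ?_⟩
  · refine Integrable.of_bound (C := 1)
      (Finset.measurable_fun_prod _ fun e _ => (hVm e).pow_const _).aestronglyMeasurable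
      (Filter.Eventually.of_forall fun ω => ?_)
    rw [Real.norm_eq_abs, Finset.abs_prod]
    exact Finset.prod_le_one (fun _ _ => abs_nonneg _) fun e _ => by
      rw [abs_pow]; exact pow_le_one₀ (abs_nonneg _) (hV1 ω e)
  -- A vanishing variable with positive exponent makes the left side zero.
  by_cases hm : ∃ e, ¬ S e ∧ m e ≠ 0
  · obtain ⟨e, he, hme⟩ := hm
    have h0 : ∀ ω, ∏ e, V ω e ^ m e = 0 := fun ω =>
      Finset.prod_eq_zero (Finset.mem_univ e) (by rw [hV0 e he, zero_pow hme])
    simp_rw [h0, integral_zero]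
    exact Finset.prod_nonneg fun e _ => hfac0 _
  push Not at hm
  have hprod : ∀ ω, ∏ e, V ω e ^ m e = ∏ e : {e // S e}, Z e ω ^ m e := by
    intro ω
    rw [← Fintype.prod_subtype_mul_prod_subtype S]
    rw [Finset.prod_eq_one (s := Finset.univ) (f := fun e : {e // ¬ S e} => V ω e ^ m e)
      fun e _ => by rw [hm e e.2, pow_zero], mul_one]
    exact Finset.prod_congr rfl fun e _ => by rw [hVS]
  have hprod' : (∏ e, if m e = 0 then 1 else p * refMoment (m e)) =
      ∏ e : {e // S e}, if m e = 0 then 1 else p * refMoment (m e) := by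
    rw [← Fintype.prod_subtype_mul_prod_subtype S]
    rw [Finset.prod_eq_one (s := Finset.univ)
      (f := fun e : {e // ¬ S e} => if m e = 0 then 1 else p * refMoment (m e))
      fun e _ => if_pos (hm e e.2), mul_one]
  simp_rw [hprod]
  rw [hprod', hZ.integral_fun_prod_comp (f := fun (e : {e // S e}) (x : ℝ) => x ^ m e)
    (fun e => (hZm e).aemeasurable)
    fun e => (measurable_id.pow_const _).aestronglyMeasurable]
  refine (le_abs_self _).trans ?_
  rw [Finset.abs_prod]
  refine Finset.prod_le_prod (fun _ _ => abs_nonneg _) fun e _ => ?_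
  rcases Nat.lt_or_ge (m e) 2 with h2 | h2
  · interval_cases h : m e
    · simp
    · simp [hZ0, refMoment_one]
  · rw [if_neg (by omega)]
    calc |∫ ω, Z e ω ^ m e ∂μ| ≤ ∫ ω, |Z e ω ^ m e| ∂μ := abs_integral_le_integral_abs
      _ ≤ ∫ ω, Z e ω ^ 2 ∂μ := by
          refine integral_mono_of_nonneg (Filter.Eventually.of_forall fun ω => abs_nonneg _) ?_
            (Filter.Eventually.of_forall fun ω => ?_)
          · refine Integrable.of_bound (C := 1) ((hZm e).pow_const _).aestronglyMeasurable
              (Filter.Eventually.of_forall fun ω => ?_)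
            rw [Real.norm_eq_abs, abs_pow]
            exact pow_le_one₀ (abs_nonneg _) (hZ1 e ω)
          · change |Z e ω ^ m e| ≤ Z e ω ^ 2
            rw [abs_pow, ← sq_abs (Z e ω)]
            exact pow_le_pow_of_le_one (abs_nonneg _) (hZ1 e ω) h2
      _ ≤ p * 1 := by rw [mul_one]; exact hZ2 e
      _ ≤ p * refMoment (m e) := by gcongr; exact one_le_refMoment h2

lemma IsInhomogeneousER.integral_eq {Ω : Type*} [MeasurableSpace Ω] {μ : Measure Ω} {n m : ℕ}
    {P : Matrix (Fin n ⊕ Fin m) (Fin n ⊕ Fin m) ℝ}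
    {A : Ω → Matrix (Fin n ⊕ Fin m) (Fin n ⊕ Fin m) ℝ} (hA : IsInhomogeneousER μ P A)
    {i j : Fin n ⊕ Fin m} (hij : toLex i < toLex j) : ∫ ω, A ω i j ∂μ = P i j := by
  rw [← hA.bernoulli i j hij]
  have h1 : (fun ω => A ω i j) = Set.indicator {ω | A ω i j = 1} 1 := by
    funext ω
    rcases hA.zero_or_one ω i j with h | h
    · rw [Set.indicator_of_notMem (by simp [h]), h]
    · rw [Set.indicator_of_mem (by exact h), h, Pi.one_apply]
  rw [h1]
  exact integral_indicator_one ((hA.measurable i j) (measurableSet_singleton 1))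

/-- The part of a noise block that lies strictly above the diagonal of the network is a matrix
of independent entries. -/
lemma IsInhomogeneousER.exists_opNorm_upper_le {Ω : Type*} [MeasurableSpace Ω] {μ : Measure Ω}
    [IsProbabilityMeasure μ] {n m : ℕ} {P : Matrix (Fin n ⊕ Fin m) (Fin n ⊕ Fin m) ℝ}
    {A : Ω → Matrix (Fin n ⊕ Fin m) (Fin n ⊕ Fin m) ℝ} (hA : IsInhomogeneousER μ P A)
    (hP : ∀ i j, P i j ∈ Set.Icc (0 : ℝ) 1) {p : ℝ} (hp0 : 0 < p) (hp1 : p ≤ 1)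
    (hPp : ∀ i j, P i j ≤ p) {α β : Type*} [Fintype α] [DecidableEq α] [Fintype β] [DecidableEq β]
    {φ : α → Fin n ⊕ Fin m} {χ : β → Fin n ⊕ Fin m} (hφ : φ.Injective) (hχ : χ.Injective)
    {x : ℝ} (hx1 : 1 ≤ x) (hα : p * Fintype.card α ≤ x) (hβ : p * Fintype.card β ≤ x) :
    ∃ S : Set Ω, μ.real S ≤ Real.exp (-2 * x) / p ∧ ∀ ω ∉ S,
      ‖(Matrix.of fun i j => if toLex (φ i) < toLex (χ j) then A ω (φ i) (χ j) - P (φ i) (χ j)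
        else 0 : Matrix α β ℝ)‖ ≤ Real.exp 57 * Real.sqrt x := by
  set Z : {e : α × β // toLex (φ e.1) < toLex (χ e.2)} → Ω → ℝ :=
    fun e ω => A ω (φ e.1.1) (χ e.1.2) - P (φ e.1.1) (χ e.1.2) with hZdef
  have hZ : iIndepFun Z μ := by
    have h1 := hA.indep.precomp (g := fun e : {e : α × β // toLex (φ e.1) < toLex (χ e.2)} =>
      (⟨(φ e.1.1, χ e.1.2), e.2⟩ :
        {e : (Fin n ⊕ Fin m) × (Fin n ⊕ Fin m) // toLex e.1 < toLex e.2})) (by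
      intro e e' h
      have h' := Prod.ext_iff.1 (Subtype.ext_iff.1 h)
      exact Subtype.ext (Prod.ext (hφ h'.1) (hχ h'.2)))
    exact h1.comp (fun e x => x - P (φ e.1.1) (χ e.1.2)) fun e => measurable_id.sub_const _
  have hZm : ∀ e, Measurable (Z e) := fun e => (hA.measurable _ _).sub_const _
  have hA1 : ∀ i j ω, |A ω i j| ≤ 1 := by
    intro i j ω
    rcases hA.zero_or_one ω i j with h | h <;> simp [h]
  have hAint : ∀ i j, Integrable (fun ω => A ω i j) μ := fun i j =>
    Integrable.of_bound (C := 1) (hA.measurable i j).aestronglyMeasurable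
      (Filter.Eventually.of_forall fun ω => hA1 i j ω)
  have hZ1 : ∀ e ω, |Z e ω| ≤ 1 := by
    intro e ω
    obtain ⟨h0, h1⟩ := hP (φ e.1.1) (χ e.1.2)
    rw [hZdef, abs_le]
    rcases hA.zero_or_one ω (φ e.1.1) (χ e.1.2) with h | h <;> simp only [h] <;>
      constructor <;> linarith
  have hZ0 : ∀ e, ∫ ω, Z e ω ∂μ = 0 := by
    intro e
    rw [hZdef, integral_sub (hAint _ _) (integrable_const _), hA.integral_eq e.2]
    simp
  have hZ2 : ∀ e, ∫ ω, Z e ω ^ 2 ∂μ ≤ p := by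
    intro e
    obtain ⟨h0, h1⟩ := hP (φ e.1.1) (χ e.1.2)
    have h2 : ∀ ω, Z e ω ^ 2 = (1 - 2 * P (φ e.1.1) (χ e.1.2)) * A ω (φ e.1.1) (χ e.1.2) +
        P (φ e.1.1) (χ e.1.2) ^ 2 := by
      intro ω
      rw [hZdef]
      rcases hA.zero_or_one ω (φ e.1.1) (χ e.1.2) with h | h <;> simp only [h] <;> ring
    simp_rw [h2]
    rw [integral_add ((hAint _ _).const_mul _) (integrable_const _), integral_const_mul,
      hA.integral_eq e.2]
    have := hPp (φ e.1.1) (χ e.1.2)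
    simp only [integral_const, probReal_univ, smul_eq_mul, one_mul]
    nlinarith
  have hmain := integral_prod_pow_le (κ := α × β) (S := fun e => toLex (φ e.1) < toLex (χ e.2))
    (V := fun ω e => if toLex (φ e.1) < toLex (χ e.2) then A ω (φ e.1) (χ e.2) - P (φ e.1) (χ e.2)
        else 0) hp0.le hZ hZm hZ1 hZ0 hZ2 (fun e ω => if_pos e.2) (fun e he ω => if_neg he)
  exact exists_opNorm_le (W := fun ω => Matrix.of fun i j => if toLex (φ i) < toLex (χ j) then
    A ω (φ i) (χ j) - P (φ i) (χ j) else 0) hp0 hp1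
    (fun m => (hmain m).1) (fun m => (hmain m).2) hx1 hα hβ

/-- Both noise blocks have operator norm of the order of the root of the expected degree. -/
lemma IsInhomogeneousER.exists_opNorm_noise_le {Ω : Type*} [MeasurableSpace Ω] {μ : Measure Ω}
    [IsProbabilityMeasure μ] {n m : ℕ} {P : Matrix (Fin n ⊕ Fin m) (Fin n ⊕ Fin m) ℝ}
    {A : Ω → Matrix (Fin n ⊕ Fin m) (Fin n ⊕ Fin m) ℝ} (hA : IsInhomogeneousER μ P A)
    (hPs : P.IsSymm) (hP : ∀ i j, P i j ∈ Set.Icc (0 : ℝ) 1) {p : ℝ} (hp0 : 0 < p) (hp1 : p ≤ 1)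
    (hPp : ∀ i j, P i j ≤ p) {L : ℝ} (hL : 1 ≤ L) :
    ∃ S : Set Ω, μ.real S ≤ 2 * (Real.exp (-2 * L) / p) ∧ ∀ ω ∉ S,
      ‖(A ω).toBlocks₁₁ - P.toBlocks₁₁‖ ≤ 3 * Real.exp 57 * Real.sqrt (n * p + L) ∧
      ‖(A ω).toBlocks₁₂ - P.toBlocks₁₂‖ ≤ 3 * Real.exp 57 * Real.sqrt ((n + m) * p + L) := by
  have hn0 : 0 ≤ n * p := by positivity
  have hm0 : 0 ≤ m * p := by positivity
  obtain ⟨S₁, hS₁, h₁⟩ := hA.exists_opNorm_upper_le hP hp0 hp1 hPp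
    (Sum.inl_injective (α := Fin n) (β := Fin m)) (Sum.inl_injective (α := Fin n) (β := Fin m))
    (x := n * p + L) (by linarith) (by rw [Fintype.card_fin]; linarith)
    (by rw [Fintype.card_fin]; linarith)
  obtain ⟨S₂, hS₂, h₂⟩ := hA.exists_opNorm_upper_le hP hp0 hp1 hPp
    (Sum.inl_injective (α := Fin n) (β := Fin m)) (Sum.inr_injective (α := Fin n) (β := Fin m))
    (x := (n + m) * p + L) (by linarith) (by rw [Fintype.card_fin]; linarith)
    (by rw [Fintype.card_fin]; linarith)
  refine ⟨S₁ ∪ S₂, ?_, fun ω hω => ⟨?_, ?_⟩⟩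
  · refine (measureReal_union_le _ _).trans ?_
    rw [two_mul]
    refine add_le_add (hS₁.trans ?_) (hS₂.trans ?_) <;>
    · refine div_le_div_of_nonneg_right (Real.exp_le_exp.2 ?_) hp0.le
      linarith
  · have hU := h₁ ω fun h => hω (Or.inl h)
    set U : Matrix (Fin n) (Fin n) ℝ := Matrix.of fun i j =>
      if toLex (Sum.inl i : Fin n ⊕ Fin m) < toLex (Sum.inl j) then
        A ω (Sum.inl i) (Sum.inl j) - P (Sum.inl i) (Sum.inl j) else 0 with hUdef
    set D : Matrix (Fin n) (Fin n) ℝ := Matrix.diagonal fun i =>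
      A ω (Sum.inl i) (Sum.inl i) - P (Sum.inl i) (Sum.inl i) with hD
    have hdecomp : (A ω).toBlocks₁₁ - P.toBlocks₁₁ = U + Uᵀ + D := by
      ext i j
      have hAs := (hA.symm ω).apply (Sum.inl i) (Sum.inl j)
      have hPs' := hPs.apply (Sum.inl i) (Sum.inl j)
      simp only [Matrix.toBlocks₁₁, hUdef, hD, Matrix.sub_apply, Matrix.add_apply, Matrix.of_apply,
        Matrix.transpose_apply, Matrix.diagonal_apply, Sum.Lex.toLex_lt_toLex, Sum.lex_inl_inl]
      rcases lt_trichotomy i j with h | rfl | h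
      · simp [h, h.not_gt, h.ne]
      · simp
      · simp [h, h.not_gt, h.ne', hAs, hPs']
    have hDn : ‖D‖ ≤ 1 := by
      refine opNorm_diagonal_le zero_le_one fun i => ?_
      obtain ⟨h0, h1⟩ := hP (Sum.inl i) (Sum.inl i)
      rw [abs_le]
      rcases hA.zero_or_one ω (Sum.inl i) (Sum.inl i) with h | h <;> rw [h] <;>
        constructor <;> linarith
    have h1 : 1 ≤ Real.exp 57 * Real.sqrt (n * p + L) :=
      one_le_mul_of_one_le_of_one_le (Real.one_le_exp (by norm_num))
        (Real.one_le_sqrt.2 (by linarith))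
    rw [hdecomp]
    have h2 := norm_add_le (U + Uᵀ) D
    have h3 := norm_add_le U Uᵀ
    rw [opNorm_transpose] at h3
    linarith
  · have hU := h₂ ω fun h => hω (Or.inr h)
    have hdecomp : (A ω).toBlocks₁₂ - P.toBlocks₁₂ = (Matrix.of fun (i : Fin n) (j : Fin m) =>
      if toLex (Sum.inl i : Fin n ⊕ Fin m) < toLex (Sum.inr j) then
        A ω (Sum.inl i) (Sum.inr j) - P (Sum.inl i) (Sum.inr j) else 0) := by
      ext i j
      simp [Matrix.toBlocks₁₂]
    rw [hdecomp]
    refine hU.trans ?_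
    have : 0 ≤ Real.exp 57 * Real.sqrt ((n + m) * p + L) := by positivity
    linarith

/-! ### Consequences of admissibility -/

lemma le_pMax {α β : Type*} [Finite α] [Finite β] (P : Matrix α β ℝ) (i : α) (j : β) :
    P i j ≤ pMax P :=
  le_ciSup (f := fun e : α × β => P e.1 e.2) (Set.finite_range _).bddAbove (i, j)

lemma sigma_rank_mul_norm_le {α β : Type*} [Fintype α] [Fintype β] [DecidableEq β]
    (M : Matrix α β ℝ) {x : EuclideanSpace ℝ β}
    (hx : x ∈ (LinearMap.ker (Matrix.toLpLin 2 2 M))ᗮ) :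
    sigma M.rank M * ‖x‖ ≤ ‖Matrix.toLpLin 2 2 M x‖ := by
  have h := singularValues_mul_norm_le (Matrix.toLpLin 2 2 M) hx
  rwa [Matrix.toLpLin_eq_toLin, ← Matrix.rank_eq_finrank_range_toLin,
    ← Matrix.toLpLin_eq_toLin] at h

lemma frobNorm_le_of_abs_le {α β : Type*} [Fintype α] [Fintype β] {M : Matrix α β ℝ} {p : ℝ}
    (hp : 0 ≤ p) (h : ∀ i j, |M i j| ≤ p) :
    frobNorm M ≤ p * Real.sqrt (Fintype.card α * Fintype.card β) := by
  refine abs_le_of_sq_le_sq' ?_ (by positivity) |>.2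
  rw [frobNorm_sq, mul_pow, Real.sq_sqrt (by positivity)]
  calc ∑ i, ∑ j, M i j ^ 2 ≤ ∑ _i : α, ∑ _j : β, p ^ 2 :=
        Finset.sum_le_sum fun i _ => Finset.sum_le_sum fun j _ =>
          sq_le_sq.2 ((h i j).trans (le_abs_self p))
    _ = _ := by simp; ring

/-- The final bookkeeping, in terms of the ratio `ρ = N / n ≥ 1` and the expected degree
`q = n p* ≥ 1`. -/
lemma error_terms_le {ψ C₁ ρ q δ₁ δ₂ F s : ℝ} (hψ : 0 < ψ) (hC₁ : 0 ≤ C₁) (hρ : 1 ≤ ρ) (hq : 1 ≤ q)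
    (hs : s = ψ⁻¹ * q) (hF0 : 0 ≤ F) (hδ₁0 : 0 ≤ δ₁) (hδ₂0 : 0 ≤ δ₂)
    (hF : F ≤ q * Real.sqrt ρ) (hδ₁ : δ₁ ≤ C₁ * Real.sqrt q)
    (hδ₂ : δ₂ ≤ C₁ * (Real.sqrt ρ * Real.sqrt q)) :
    12 * (δ₁ + δ₂) + 20 * (F / s) ^ 2 * δ₁ + 4 / s * δ₂ * F + 2 / s * δ₂ ^ 2 ≤
      (24 * C₁ + 20 * ψ ^ 2 * C₁ + 4 * ψ * C₁ + 2 * ψ * C₁ ^ 2) * (ρ ^ 2 * Real.sqrt q) := by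
  have hq0 : 0 < q := by linarith
  have hs0 : 0 < s := by rw [hs]; positivity
  set a := Real.sqrt ρ with ha
  set b := Real.sqrt q with hb
  have ha2 : a ^ 2 = ρ := Real.sq_sqrt (by linarith)
  have hb2 : b ^ 2 = q := Real.sq_sqrt hq0.le
  have ha1 : 1 ≤ a := Real.one_le_sqrt.2 hρ
  have hb1 : 1 ≤ b := Real.one_le_sqrt.2 hq
  have e1 : 12 * (δ₁ + δ₂) ≤ 24 * C₁ * (a ^ 4 * b) := by
    have h1 : (1 : ℝ) ≤ a ^ 4 := one_le_pow₀ ha1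
    have h2 : a ≤ a ^ 4 := le_self_pow₀ ha1 (by norm_num)
    calc 12 * (δ₁ + δ₂) ≤ 12 * (C₁ * (1 * b) + C₁ * (a * b)) := by
          rw [one_mul]; gcongr
      _ ≤ 12 * (C₁ * (a ^ 4 * b) + C₁ * (a ^ 4 * b)) := by gcongr
      _ = _ := by ring
  have e2 : 20 * (F / s) ^ 2 * δ₁ ≤ 20 * ψ ^ 2 * C₁ * (a ^ 4 * b) := by
    calc 20 * (F / s) ^ 2 * δ₁ ≤ 20 * (q * a / s) ^ 2 * (C₁ * b) := by gcongr
      _ = 20 * ψ ^ 2 * C₁ * (a ^ 2 * b) := by rw [hs]; field_simp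
      _ ≤ _ := by
          gcongr
          norm_num
  have e3 : 4 / s * δ₂ * F ≤ 4 * ψ * C₁ * (a ^ 4 * b) := by
    calc 4 / s * δ₂ * F ≤ 4 / s * (C₁ * (a * b)) * (q * a) := by gcongr
      _ = 4 * ψ * C₁ * (a ^ 2 * b) := by rw [hs]; field_simp
      _ ≤ _ := by
          gcongr
          norm_num
  have e4 : 2 / s * δ₂ ^ 2 ≤ 2 * ψ * C₁ ^ 2 * (a ^ 4 * b) := by
    calc 2 / s * δ₂ ^ 2 ≤ 2 / s * (C₁ * (a * b)) ^ 2 := by gcongr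
      _ = 2 * ψ * C₁ ^ 2 * (a ^ 2 * 1) := by
          rw [hs, mul_pow, mul_pow, hb2]; field_simp
      _ ≤ _ := by
          gcongr
          norm_num
  have hρ2 : ρ ^ 2 = a ^ 4 := by rw [← ha2]; ring
  rw [hρ2]
  linarith

lemma eq_zero_of_rank_eq_zero {α β : Type*} [Finite α] [Fintype β] [DecidableEq β]
    {M : Matrix α β ℝ} (h : M.rank = 0) : M = 0 := by
  have h1 : M.mulVecLin = 0 := LinearMap.range_eq_bot.1 (Submodule.finrank_eq_zero.1 h)
  ext i j
  simpa using congrFun (LinearMap.congr_fun h1 (Pi.single j 1)) i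

/-- The claimed error bound, for networks whose noise blocks have operator norm of the order of the
root of the expected degree and whose expected degree is large enough. -/
lemma IsAdmissible.frobNorm_sub_le {ψ c₁ c₂ D : ℝ} {N n m K : ℕ} (hψ : 0 < ψ) (hc₂ : 0 < c₂)
    (hD : 0 ≤ D) {P : Matrix (Fin n ⊕ Fin m) (Fin n ⊕ Fin m) ℝ}
    (hadm : IsAdmissible ψ c₁ c₂ N n m K P) (hn1 : 1 ≤ n) (hp0 : 0 < pMax P)
    (hL1 : 1 ≤ Real.log n) (hq1 : 1 ≤ n * pMax P)
    (hq2 : (2 * ψ * (D * Real.sqrt (1 + c₂⁻¹))) ^ 2 ≤ n * pMax P)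
    {A Phat : Matrix (Fin n ⊕ Fin m) (Fin n ⊕ Fin m) ℝ}
    (hW₁ : ‖A.toBlocks₁₁ - P.toBlocks₁₁‖ ≤ D * Real.sqrt (n * pMax P + Real.log n))
    (hW₂ : ‖A.toBlocks₁₂ - P.toBlocks₁₂‖ ≤ D * Real.sqrt ((n + m) * pMax P + Real.log n))
    {b₁ b₂ b₃ : Bool} (hPhat : IsFullEstimate b₁ b₂ b₃ K A Phat) {C₁ : ℝ}
    (hC₁ : C₁ = D * Real.sqrt (1 + c₂⁻¹)) :
    frobNorm (Phat - P) ≤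
      (24 * C₁ + 20 * ψ ^ 2 * C₁ + 4 * ψ * C₁ + 2 * ψ * C₁ ^ 2) * (Real.sqrt K *
        (((N : ℝ) / n) ^ (3 / 2 : ℝ) * Real.sqrt (K * N * pMax P)
          + (N : ℝ) ^ 2 / (n : ℝ) ^ 2 * Real.log n)) := by
  have hC₁0 : 0 ≤ C₁ := by rw [hC₁]; positivity
  have hn0 : (0 : ℝ) < n := by exact_mod_cast hn1
  set p := pMax P with hp
  set L := Real.log n with hL
  set q : ℝ := n * p with hqdef
  have hqL : c₂ * L ≤ q := hadm.density
  have hPp : ∀ i j, P i j ≤ p := le_pMax P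
  have hN : (N : ℝ) = n + m := by rw [hadm.card]; push_cast; rfl
  have hm0 : (0 : ℝ) ≤ m := by positivity
  have hNn : (n : ℝ) ≤ N := by linarith
  set ρ : ℝ := N / n with hρdef
  have hρ1 : 1 ≤ ρ := (one_le_div hn0).2 hNn
  have hNρ : (N : ℝ) = ρ * n := by rw [hρdef]; field_simp
  have hNp : N * p = ρ * q := by rw [hqdef, hNρ]; ring
  have hLq : L ≤ c₂⁻¹ * q := by
    rw [inv_mul_eq_div, le_div_iff₀ hc₂]; linarith
  have hδ₁ : ‖A.toBlocks₁₁ - P.toBlocks₁₁‖ ≤ C₁ * Real.sqrt q := by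
    refine hW₁.trans ?_
    rw [hC₁, mul_assoc D, ← Real.sqrt_mul (by positivity)]
    gcongr
    linarith
  have hδ₂ : ‖A.toBlocks₁₂ - P.toBlocks₁₂‖ ≤ C₁ * (Real.sqrt ρ * Real.sqrt q) := by
    refine hW₂.trans ?_
    rw [hC₁, mul_assoc D, ← Real.sqrt_mul (by positivity),
      ← Real.sqrt_mul (by positivity), ← hN, hNp]
    gcongr
    have : q ≤ ρ * q := le_mul_of_one_le_left (by linarith) hρ1
    have : c₂⁻¹ * q ≤ c₂⁻¹ * (ρ * q) := by gcongr
    linarith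
  set s : ℝ := ψ⁻¹ * q with hs
  have hs0 : 0 < s := by rw [hs]; positivity
  have hs2 : C₁ * Real.sqrt q ≤ s / 2 := by
    have h1 : 2 * ψ * C₁ ≤ Real.sqrt q := Real.le_sqrt_of_sq_le (by rwa [hC₁])
    have h2 : q = Real.sqrt q * Real.sqrt q := (Real.mul_self_sqrt (by linarith)).symm
    have h3 : 2 * ψ * C₁ * Real.sqrt q ≤ q := by
      nth_rw 2 [h2]
      gcongr
    rw [hs, inv_mul_eq_div, div_div, le_div_iff₀ (by positivity)]
    linarith
  have hrank : P.rank = P.toBlocks₁₁.rank := hadm.rank_eq.trans hadm.rank_block_eq.symm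
  have hsx : ∀ x ∈ (LinearMap.ker (Matrix.toLpLin 2 2 P.toBlocks₁₁))ᗮ,
      s * ‖x‖ ≤ ‖Matrix.toLpLin 2 2 P.toBlocks₁₁ x‖ := by
    intro x hx
    refine le_trans ?_ (sigma_rank_mul_norm_le _ hx)
    rw [hadm.rank_block_eq]
    exact mul_le_mul_of_nonneg_right hadm.block_lower (norm_nonneg _)
  have hF : frobNorm P.toBlocks₁₂ ≤ q * Real.sqrt ρ := by
    refine (frobNorm_le_of_abs_le hp0.le fun i j => ?_).trans ?_
    · exact (abs_of_nonneg (hadm.mem_Icc (Sum.inl i) (Sum.inr j)).1).trans_le (hPp _ _)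
    · rw [Fintype.card_fin, Fintype.card_fin]
      have h1 : (n : ℝ) * m ≤ n ^ 2 * ρ := by
        calc (n : ℝ) * m ≤ n * N := by gcongr; rw [hadm.card]; omega
          _ = n ^ 2 * ρ := by rw [hNρ]; ring
      calc p * Real.sqrt (n * m) ≤ p * Real.sqrt (n ^ 2 * ρ) := by gcongr
        _ = q * Real.sqrt ρ := by
            rw [Real.sqrt_mul (by positivity), Real.sqrt_sq hn0.le, hqdef]; ring
  -- Rank zero would force `P = 0`, against the lower bound on the density.
  have hK1 : (1 : ℝ) ≤ K := by
    have : K ≠ 0 := by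
      intro hK
      have hP0 : P = 0 := by
        have h1 := hadm.rank_eq
        rw [hK] at h1
        exact eq_zero_of_rank_eq_zero h1
      have : p ≤ 0 := by
        have : Nonempty (Fin n) := ⟨⟨0, hn1⟩⟩
        exact ciSup_le fun e => by rw [hP0]; rfl
      linarith
    exact_mod_cast Nat.one_le_iff_ne_zero.2 this
  have hdet := IsFullEstimate.frobNorm_sub_le hs0 hrank hadm.symm hadm.mem_Icc hsx hδ₁ hδ₂ hs2
    (hadm.rank_eq.symm ▸ hPhat)
  rw [hadm.rank_eq] at hdet
  refine hdet.trans ?_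
  have herr := error_terms_le hψ hC₁0 hρ1 hq1 hs (frobNorm_nonneg P.toBlocks₁₂)
    (by positivity) (by positivity) hF (le_refl (C₁ * Real.sqrt q))
    (le_refl (C₁ * (Real.sqrt ρ * Real.sqrt q)))
  have htarget : ρ ^ 2 * Real.sqrt q ≤ ρ ^ (3 / 2 : ℝ) * Real.sqrt (K * N * p)
      + (N : ℝ) ^ 2 / (n : ℝ) ^ 2 * L := by
    have hρ0 : 0 < ρ := by linarith
    have h1 : ρ ^ 2 * Real.sqrt q = ρ ^ (3 / 2 : ℝ) * Real.sqrt (ρ * q) := by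
      rw [Real.sqrt_mul hρ0.le, ← mul_assoc, Real.sqrt_eq_rpow ρ, ← Real.rpow_add hρ0,
        ← Real.rpow_natCast ρ 2]
      norm_num
    have h2 : ρ * q ≤ K * N * p := by
      rw [mul_assoc, hNp]
      exact le_mul_of_one_le_left (by positivity) hK1
    rw [h1]
    have h3 : 0 ≤ (N : ℝ) ^ 2 / (n : ℝ) ^ 2 * L := by positivity
    have h4 : ρ ^ (3 / 2 : ℝ) * Real.sqrt (ρ * q) ≤ ρ ^ (3 / 2 : ℝ) * Real.sqrt (K * N * p) := by
      gcongr
    linarith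
  calc _ ≤ Real.sqrt K * ((24 * C₁ + 20 * ψ ^ 2 * C₁ + 4 * ψ * C₁ + 2 * ψ * C₁ ^ 2) *
        (ρ ^ 2 * Real.sqrt q)) := mul_le_mul_of_nonneg_left herr (Real.sqrt_nonneg _)
    _ = (24 * C₁ + 20 * ψ ^ 2 * C₁ + 4 * ψ * C₁ + 2 * ψ * C₁ ^ 2) *
        (Real.sqrt K * (ρ ^ 2 * Real.sqrt q)) := by ring
    _ ≤ _ := by gcongr

end Egocentric

end

theorem corollary1 (ψ c₁ c₂ : ℝ) (hψ : 0 < ψ) (hc₁ : 0 < c₁) (hc₂ : 0 < c₂) :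
    ∃ C : ℝ, 0 < C ∧ ∀ ε : ℝ, 0 < ε → ∃ n₀ : ℕ, ∀ N n m K : ℕ, n₀ ≤ n →
      ∀ P : Matrix (Fin n ⊕ Fin m) (Fin n ⊕ Fin m) ℝ,
        Egocentric.IsAdmissible ψ c₁ c₂ N n m K P →
      ∀ (Ω : Type*) [MeasurableSpace Ω] (μ : Measure Ω) [IsProbabilityMeasure μ]
        (A : Ω → Matrix (Fin n ⊕ Fin m) (Fin n ⊕ Fin m) ℝ),
        Egocentric.IsInhomogeneousER μ P A →
        1 - ε ≤ μ.real {ω | ∀ (symmetrize clipObs clipMiss : Bool)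
            (Phat : Matrix (Fin n ⊕ Fin m) (Fin n ⊕ Fin m) ℝ),
            Egocentric.IsFullEstimate symmetrize clipObs clipMiss K (A ω) Phat →
            Egocentric.frobNorm (Phat - P) ≤
              C * (Real.sqrt K *
                (((N : ℝ) / n) ^ (3 / 2 : ℝ) * Real.sqrt (K * N * Egocentric.pMax P)
                  + (N : ℝ) ^ 2 / (n : ℝ) ^ 2 * Real.log n))} := by
  open Egocentric in
  set C₁ : ℝ := 3 * Real.exp 57 * Real.sqrt (1 + c₂⁻¹) with hC₁
  have hC₁0 : 0 < C₁ := by positivity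
  refine ⟨24 * C₁ + 20 * ψ ^ 2 * C₁ + 4 * ψ * C₁ + 2 * ψ * C₁ ^ 2, by positivity, fun ε hε => ?_⟩
  have hlog : Filter.Tendsto (fun n : ℕ => c₂ * Real.log n) Filter.atTop Filter.atTop :=
    (Real.tendsto_log_atTop.comp tendsto_natCast_atTop_atTop).const_mul_atTop hc₂
  obtain ⟨n₀, hn₀⟩ := Filter.eventually_atTop.1
    ((hlog.eventually_ge_atTop (max (max 1 c₂) ((2 * ψ * C₁) ^ 2))).and
      ((tendsto_natCast_atTop_atTop (R := ℝ)).eventually_ge_atTop (2 / ε)))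
  refine ⟨max n₀ 1, fun N n m K hn P hadm Ω _ μ _ A hA => ?_⟩
  obtain ⟨hlogn, hnε⟩ := hn₀ n (le_of_max_le_left hn)
  have hn1 : 1 ≤ n := le_of_max_le_right hn
  have hn0 : (0 : ℝ) < n := by exact_mod_cast hn1
  obtain ⟨hl', hl3⟩ := max_le_iff.1 hlogn
  obtain ⟨hl1, hl2⟩ := max_le_iff.1 hl'
  have hL1 : 1 ≤ Real.log n := by
    by_contra h
    nlinarith
  set p := pMax P with hp
  set L := Real.log n with hL
  set q : ℝ := n * p with hqdef
  have hqL : c₂ * L ≤ q := hadm.density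
  have hq1 : 1 ≤ q := hl1.trans hqL
  have hp0 : 0 < p := by
    by_contra h
    have : q ≤ 0 := mul_nonpos_of_nonneg_of_nonpos hn0.le (not_lt.1 h)
    linarith
  have hp1 : p ≤ 1 := by
    have : Nonempty (Fin n) := ⟨⟨0, hn1⟩⟩
    exact ciSup_le fun e => (hadm.mem_Icc e.1 e.2).2
  have hPp : ∀ i j, P i j ≤ p := le_pMax P
  -- The bounds on the noise hold outside of a set of probability at most `2 / n`.
  obtain ⟨S, hS, hnoise⟩ := hA.exists_opNorm_noise_le hadm.symm hadm.mem_Icc hp0 hp1 hPp hL1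
  have hSε : μ.real S ≤ ε := by
    refine hS.trans ?_
    have h1 : Real.exp (-2 * L) = (n : ℝ)⁻¹ * (n : ℝ)⁻¹ := by
      rw [show -2 * L = -L + -L by ring, Real.exp_add, Real.exp_neg, hL, Real.exp_log hn0]
    rw [h1]
    calc 2 * ((n : ℝ)⁻¹ * (n : ℝ)⁻¹ / p) = 2 / n / q := by rw [hqdef]; field_simp
      _ ≤ 2 / n := div_le_self (by positivity) hq1
      _ ≤ ε := by
          rw [div_le_iff₀ hn0]
          rw [div_le_iff₀ hε] at hnε
          linarith
  set G : Set Ω := {ω | ∀ (symmetrize clipObs clipMiss : Bool)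
    (Phat : Matrix (Fin n ⊕ Fin m) (Fin n ⊕ Fin m) ℝ), _} with hG
  suffices hSG : ∀ ω ∉ S, ω ∈ G by
    have hcov : (Set.univ : Set Ω) ⊆ G ∪ S := fun ω _ => by
      by_cases h : ω ∈ S
      · exact Or.inr h
      · exact Or.inl (hSG ω h)
    have h1 : (1 : ℝ) ≤ μ.real G + μ.real S := by
      calc (1 : ℝ) = μ.real Set.univ := by simp
        _ ≤ μ.real (G ∪ S) := measureReal_mono hcov
        _ ≤ _ := measureReal_union_le _ _
    linarith
  intro ω hω b₁ b₂ b₃ Phat hPhat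
  obtain ⟨hW₁, hW₂⟩ := hnoise ω hω
  exact hadm.frobNorm_sub_le hψ hc₂ (by positivity) hn1 hp0 hL1 hq1 (hl3.trans hqL) hW₁ hW₂ hPhat
    hC₁
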